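/- Let $d\ge 1$ and let $a_1,b_1,\dots,a_d,b_d\ge 1$ be integers. Consider the admissible index \[ \boldsymbol{k}=(k_1,\dots,k_r):=(\underbrace{1,\ldots,1}_{a_1-1},b_1+1,\dots,\underbrace{1,\ldots,1}_{a_d-1},b_d+1), \qquad r=a_1+\cdots+a_d , \] and let $s\in\mathbb{C}$ with $\Re(s)>-1$. Let $I_{\boldsymbol{k}}(s)$ be the Ohno function \[ I_{\boldsymbol{k}}(s):=\sum_{i=1}^{r}\ \sum_{0<n_1<\cdots<n_r}\frac{1}{n_1^{k_1}\cdots n_r^{k_r}}\cdot\frac{1}{n_i^{s}}\prod_{j\ne i}\frac{n_j}{n_j-n_i}, \] where the $n_j$ are integers. Then for each $i$ the inner series converges absolutely, the integral below converges absolutely (with respect to Lebesgue measure on $\mathbb{R}^{2d}$), and \begin{align*} I_{\boldsymbol{k}}(s)={}&\frac{1}{(a_1-1)!\,(b_1-1)!\cdots(a_d-1)!\,(b_d-1)!\,\Gamma(s+1)}\\ &\times\int_{0<t_1<\cdots<t_{2d}<1}\left(\log\frac{t_2t_4\cdots t_{2d}}{t_1t_3\cdots t_{2d-1}}\right)^{s}\\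 &\qquad\times\prod_{l=1}^{d}\left(\log\frac{1-t_{2l-1}}{1-t_{2l}}\right)^{a_l-1}\left(\log\frac{t_{2l+1}}{t_{2l}}\right)^{b_l-1}\frac{dt_{2l-1}\,dt_{2l}}{(1-t_{2l-1})\,t_{2l}}, \end{align*} where $t_{2d+1}:=1$. -/

import Mathlib

namespace Ohno

/-- The index `(1^{a₁-1}, b₁+1, …, 1^{a_d-1}, b_d+1)`, where `1^m` is a string of `m` ones. -/
def blockIndex {d : ℕ} (a b : Fin d → ℕ) : List ℕ :=
  (List.ofFn fun i => List.replicate (a i - 1) 1 ++ [b i + 1]).flatten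

/-- The tuples `0 < n₁ < ⋯ < n_r` of integers. -/
def summationTuples (r : ℕ) : Set (Fin r → ℕ) :=
  {n | (∀ j, 0 < n j) ∧ StrictMono n}

/-- The summand
`1 / (n₁^{k₁} ⋯ n_r^{k_r}) * (1 / n_i^s) * ∏_{j ≠ i} n_j / (n_j - n_i)`. -/
noncomputable def ohnoTerm (k : List ℕ) (s : ℂ) (i : Fin k.length) (n : Fin k.length → ℕ) : ℂ :=
  (1 / ∏ j, (n j : ℂ) ^ k.get j) * (1 / (n i : ℂ) ^ s) *
    ∏ j ∈ Finset.univ.erase i, (n j : ℂ) / ((n j : ℂ) - (n i : ℂ))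

/-- The Ohno function
`I_k(s) = ∑_{i=1}^r ∑_{0 < n₁ < ⋯ < n_r} ohnoTerm k s i n`, with `k` of depth `r`. -/
noncomputable def ohnoFunction (k : List ℕ) (s : ℂ) : ℂ :=
  ∑ i : Fin k.length, ∑' n : summationTuples k.length, ohnoTerm k s i n

/-- The region `0 < t₁ < ⋯ < t_m < 1`. -/
def orderedSimplex (m : ℕ) : Set (Fin m → ℝ) :=
  {t | (∀ j, t j ∈ Set.Ioo (0 : ℝ) 1) ∧ StrictMono t}

/-- The coordinate `t_n` for `1 ≤ n ≤ m`, with the convention `t_{m+1} = 1`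
(the coordinates of `t : Fin m → ℝ` are numbered from `0`, so `t_n` is the one at `n - 1`). -/
noncomputable def coord {m : ℕ} (t : Fin m → ℝ) (n : ℕ) : ℝ :=
  if h : n - 1 < m then t ⟨n - 1, h⟩ else 1

/-- The integrand
`∏_{l=1}^d (log ((1-t_{2l-1})/(1-t_{2l})))^{a_l-1} (log (t_{2l+1}/t_{2l}))^{b_l-1}
  / ((1-t_{2l-1}) t_{2l})`
times `(log (t₂ t₄ ⋯ t_{2d} / (t₁ t₃ ⋯ t_{2d-1})))^s`, where `t_{2d+1} = 1`.
Here `l = i + 1` for `i : Fin d`. -/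
noncomputable def ohnoIntegrand {d : ℕ} (a b : Fin d → ℕ) (s : ℂ) (t : Fin (2 * d) → ℝ) : ℂ :=
  ((∏ i : Fin d,
      1 / ((1 - coord t (2 * i + 1)) * coord t (2 * i + 2)) *
        Real.log ((1 - coord t (2 * i + 1)) / (1 - coord t (2 * i + 2))) ^ (a i - 1) *
        Real.log (coord t (2 * i + 3) / coord t (2 * i + 2)) ^ (b i - 1) : ℝ) : ℂ) *
    ((Real.log ((∏ i : Fin d, coord t (2 * i + 2)) / ∏ i : Fin d, coord t (2 * i + 1)) : ℝ) : ℂ)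
      ^ s

end Ohno

/-! ### Logarithmic kernels on the interval and their basic integrals. -/

namespace Ohno

open MeasureTheory Set
open scoped ENNReal Nat

/-! Both sides, multiplied by `Γ(s+1)`, are the integral of `x^s` against one and the same positive
measure on `(0,∞)`.

On the series side, convolving the measures `e^{-n_j x} dx` gives, by partial fractions, the density
`∑_i e^{-n_i x} ∏_{j≠i} (n_j-n_i)⁻¹` (`expIter_eq_lintegral_expDensity`). Its integral against `x^s`
is `Γ(s+1) ∑_i n_i^{-s-1} ∏_{j≠i} (n_j-n_i)⁻¹`; weighting by `∏ n_j^{-(k_j-1)}` and summing over all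
tuples yields `Γ(s+1) I_k(s)`.

On the integral side, the measure is the law of `log (t₂t₄⋯/(t₁t₃⋯))` under the normalised block
density. To compare the two, test against an arbitrary measurable `f ≥ 0`, so that every interchange
is Tonelli, and build the index from its last entry to its first. The invariant is that the sum over
`m < n₁ < ⋯` equals `∫ w τ^m f(u)`, where `τ` is the smallest variable. Dividing by a power of `n`
inserts a kernel in `dt/t`. Summing over `n > m` against `e^{-ny} dy` becomes, with `σ = τ e^{-y}`,
a geometric series: it inserts `dσ/(1-σ)` and adds `log (τ/σ)` to `u`. This gives
`represents_tailSum_blockIndex`, and then the equality of measures `sum_tupleMeasure_blockIndex`.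

Convergence comes from the series: `summable_ohnoTerm` is a direct estimate, and since the measures
are positive and `|x^s| = x^{Re s}`, summability at the real exponent `Re s` gives integrability at
`s`. -/

/-- The kernel `(log ((1-σ)/(1-τ)))^a / (a! (1-σ))` on `0 < σ < τ`. -/
noncomputable def oneKernel (a : ℕ) (τ σ : ℝ) : ℝ≥0∞ :=
  if 0 < σ ∧ σ < τ then
    ENNReal.ofReal (Real.log ((1 - σ) / (1 - τ)) ^ a / (a ! : ℝ) / (1 - σ)) else 0

/-- The kernel `(log (τ/t))^b / (b! t)` on `0 < t < τ`. -/
noncomputable def zeroKernel (b : ℕ) (τ t : ℝ) : ℝ≥0∞ :=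
  if 0 < t ∧ t < τ then ENNReal.ofReal (Real.log (τ / t) ^ b / (b ! : ℝ) / t) else 0

lemma measurable_uncurry_oneKernel (a : ℕ) :
    Measurable (Function.uncurry (oneKernel a)) := by
  unfold oneKernel
  refine Measurable.ite ?_ (by fun_prop) measurable_const
  exact (measurableSet_lt measurable_const measurable_snd).inter
    (measurableSet_lt measurable_snd measurable_fst)

lemma measurable_uncurry_zeroKernel (b : ℕ) :
    Measurable (Function.uncurry (zeroKernel b)) := by
  unfold zeroKernel
  refine Measurable.ite ?_ (by fun_prop) measurable_const
  exact (measurableSet_lt measurable_const measurable_snd).inter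
    (measurableSet_lt measurable_snd measurable_fst)

lemma Measurable.oneKernel {α : Type*} [MeasurableSpace α] (a : ℕ) {f g : α → ℝ}
    (hf : Measurable f) (hg : Measurable g) : Measurable fun x => oneKernel a (f x) (g x) :=
  (measurable_uncurry_oneKernel a).comp (hf.prodMk hg)

lemma Measurable.zeroKernel {α : Type*} [MeasurableSpace α] (b : ℕ) {f g : α → ℝ}
    (hf : Measurable f) (hg : Measurable g) : Measurable fun x => zeroKernel b (f x) (g x) :=
  (measurable_uncurry_zeroKernel b).comp (hf.prodMk hg)

/-- The substitution `σ = τ e^{-x}`. -/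
lemma lintegral_Ioo_eq_lintegral_exp {τ : ℝ} (hτ : 0 < τ) (g : ℝ → ℝ≥0∞) :
    ∫⁻ σ in Ioo 0 τ, g σ =
      ∫⁻ x in Ioi (0 : ℝ), ENNReal.ofReal (τ * Real.exp (-x)) * g (τ * Real.exp (-x)) := by
  have himg : (fun x : ℝ => τ * Real.exp (-x)) '' Ioi 0 = Ioo 0 τ := by
    ext σ
    constructor
    · rintro ⟨x, hx, rfl⟩
      have : Real.exp (-x) < 1 := Real.exp_lt_one_iff.2 (by simpa using hx)
      exact ⟨by positivity, by nlinarith⟩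
    · rintro ⟨h0, h1⟩
      refine ⟨Real.log (τ / σ), Real.log_pos ((one_lt_div h0).2 h1), ?_⟩
      simp only [← Real.log_inv]
      rw [Real.exp_log (by positivity)]
      field_simp
  rw [← himg, lintegral_image_eq_lintegral_abs_deriv_mul (f' := fun x => -(τ * Real.exp (-x)))
    measurableSet_Ioi]
  · refine lintegral_congr fun x => ?_
    rw [abs_neg, abs_of_pos (by positivity)]
  · intro x _
    have := ((hasDerivAt_neg x).exp).const_mul τ
    exact (this.congr_deriv (by ring)).hasDerivWithinAt
  · intro x _ y _ h
    simpa [hτ.ne'] using h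

lemma lintegral_ite_eq_setLIntegral_Ioo {τ : ℝ} (g : ℝ → ℝ≥0∞) :
    ∫⁻ σ, (if 0 < σ ∧ σ < τ then g σ else 0) = ∫⁻ σ in Ioo 0 τ, g σ := by
  rw [← lintegral_indicator measurableSet_Ioo]
  simp only [indicator, mem_Ioo]

lemma integrableOn_pow_mul_exp_neg_mul {b : ℕ} {r : ℝ} (hr : 0 < r) :
    IntegrableOn (fun x : ℝ => x ^ b * Real.exp (-(r * x))) (Ioi 0) := by
  have := integrableOn_rpow_mul_exp_neg_mul_rpow (p := 1) (s := b) (b := r)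
    (by have : (0 : ℝ) ≤ b := by positivity
        linarith) one_pos hr
  simpa using this

lemma integral_pow_mul_exp_neg_mul {b : ℕ} {r : ℝ} (hr : 0 < r) :
    ∫ x in Ioi (0 : ℝ), x ^ b * Real.exp (-(r * x)) = b ! / r ^ (b + 1) := by
  have := Real.integral_rpow_mul_exp_neg_mul_Ioi (a := b + 1) (r := r) (by positivity) hr
  rw [Real.Gamma_nat_eq_factorial] at this
  simp only [add_sub_cancel_right, Real.rpow_natCast] at this
  rw [this]
  norm_cast
  rw [one_div, inv_pow]
  field_simp

/-- With `t = τ e^{-x}` this is the Gamma integral of `x^b e^{-nx} / b!`; it would diverge at `n =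
0`. -/
lemma lintegral_zeroKernel_mul_pow {τ : ℝ} (hτ : 0 < τ) (b : ℕ) {n : ℕ} (hn : 0 < n) :
    ∫⁻ t, zeroKernel b τ t * ENNReal.ofReal (t ^ n) =
      ENNReal.ofReal (((n : ℝ) ^ (b + 1))⁻¹) * ENNReal.ofReal (τ ^ n) := by
  simp only [zeroKernel, ite_mul, zero_mul]
  rw [lintegral_ite_eq_setLIntegral_Ioo, lintegral_Ioo_eq_lintegral_exp hτ]
  have hn' : (0 : ℝ) < n := by exact_mod_cast hn
  have h1 : ∀ x ∈ Ioi (0 : ℝ), ENNReal.ofReal (τ * Real.exp (-x)) *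
      (ENNReal.ofReal (Real.log (τ / (τ * Real.exp (-x))) ^ b / (b ! : ℝ) / (τ * Real.exp (-x))) *
        ENNReal.ofReal ((τ * Real.exp (-x)) ^ n)) =
      ENNReal.ofReal (τ ^ n / (b ! : ℝ) * (x ^ b * Real.exp (-(n * x)))) := by
    intro x hx
    have hx' : (0 : ℝ) < x := hx
    have : τ / (τ * Real.exp (-x)) = Real.exp x := by
      rw [Real.exp_neg]; field_simp
    rw [this, Real.log_exp, ← ENNReal.ofReal_mul (by positivity),
      ← ENNReal.ofReal_mul (by positivity), mul_pow, ← Real.exp_nat_mul]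
    congr 1
    rw [mul_neg]
    field_simp
  rw [setLIntegral_congr_fun measurableSet_Ioi h1, ← ofReal_integral_eq_lintegral_ofReal,
    integral_const_mul, integral_pow_mul_exp_neg_mul hn', ← ENNReal.ofReal_mul (by positivity)]
  · congr 1
    field_simp
  · exact (integrableOn_pow_mul_exp_neg_mul hn').const_mul _
  · filter_upwards [self_mem_ae_restrict measurableSet_Ioi] with x hx
    have hx' : (0 : ℝ) < x := hx
    simp only [Pi.zero_apply]
    positivity

lemma tsum_Ioi_eq (m : ℕ) (g : ℕ → ℝ≥0∞) : ∑' n : Ioi m, g n = ∑' j : ℕ, g (m + 1 + j) := by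
  let e : ℕ ≃ Ioi m :=
    { toFun := fun j => ⟨m + 1 + j, by simp only [mem_Ioi]; omega⟩
      invFun := fun n => n - (m + 1)
      left_inv := fun j => by simp
      right_inv := fun n => by
        have := n.2
        simp only [mem_Ioi] at this
        ext; simp only; omega }
  rw [← e.tsum_eq]
  rfl

lemma tsum_Ioi_pow {q : ℝ} (h0 : 0 ≤ q) (h1 : q < 1) (m : ℕ) :
    ∑' n : Ioi m, ENNReal.ofReal (q ^ (n : ℕ)) = ENNReal.ofReal (q ^ (m + 1) / (1 - q)) := by
  rw [tsum_Ioi_eq m fun n => ENNReal.ofReal (q ^ n), div_eq_mul_inv,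
    ← ((hasSum_geometric_of_lt_one h0 h1).mul_left (q ^ (m + 1))).tsum_eq,
    ENNReal.ofReal_tsum_of_nonneg (fun n => by positivity)
      ((summable_geometric_of_lt_one h0 h1).mul_left _)]
  simp only [pow_add]

lemma oneKernel_zero (τ σ : ℝ) :
    oneKernel 0 τ σ = if 0 < σ ∧ σ < τ then ENNReal.ofReal (1 / (1 - σ)) else 0 := by
  simp [oneKernel]

/-- Put `σ = τ e^{-y}`. Then `e^{-ny} τ^n = σ^n`, the geometric series over `n > m` is
`σ^{m+1}/(1-σ)`, and one factor `σ` is absorbed by `|dσ| = σ dy`. -/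
lemma tsum_lintegral_exp_mul {τ : ℝ} (h0 : 0 < τ) (h1 : τ ≤ 1) (m : ℕ) {h : ℝ → ℝ≥0∞}
    (hh : Measurable h) :
    ∑' n : Ioi m, ∫⁻ y in Ioi (0 : ℝ),
        ENNReal.ofReal (Real.exp (-(n * y))) * (ENNReal.ofReal (τ ^ (n : ℕ)) * h y) =
      ∫⁻ σ, oneKernel 0 τ σ * (ENNReal.ofReal (σ ^ m) * h (Real.log (τ / σ))) := by
  simp only [oneKernel_zero, ite_mul, zero_mul]
  rw [lintegral_ite_eq_setLIntegral_Ioo, lintegral_Ioo_eq_lintegral_exp h0,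
    ← lintegral_tsum (fun n => by fun_prop)]
  refine setLIntegral_congr_fun measurableSet_Ioi fun y hy => ?_
  have hy' : Real.exp (-y) < 1 := Real.exp_lt_one_iff.2 (by simpa using hy)
  have hq : 0 < τ * Real.exp (-y) := by positivity
  have hq1 : τ * Real.exp (-y) < 1 := by nlinarith
  have : τ / (τ * Real.exp (-y)) = Real.exp y := by
    rw [Real.exp_neg]; field_simp
  have hn : ∀ n : ℕ, ENNReal.ofReal (Real.exp (-(n * y))) * (ENNReal.ofReal (τ ^ n) * h y) =
      ENNReal.ofReal ((τ * Real.exp (-y)) ^ n) * h y := by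
    intro n
    rw [← mul_assoc, ← ENNReal.ofReal_mul (by positivity), mul_pow, ← Real.exp_nat_mul,
      mul_neg, mul_comm (τ ^ n)]
  have h2 : (0 : ℝ) ≤ 1 / (1 - τ * Real.exp (-y)) := by
    have : 0 < 1 - τ * Real.exp (-y) := by linarith
    positivity
  simp only [hn]
  rw [ENNReal.tsum_mul_right, tsum_Ioi_pow hq.le hq1, this, Real.log_exp, ← mul_assoc, ← mul_assoc,
    ← ENNReal.ofReal_mul hq.le, ← ENNReal.ofReal_mul (by positivity)]
  congr 2
  ring

/-- With `L = log ((1-τ)/(1-t))`, the integrand `L^a / (a! (1-τ))` has antiderivative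
`-L^{a+1}/(a+1)!`, which vanishes at `τ = t`. This is how a run of ones collapses to a single power
of a logarithm. -/
lemma lintegral_oneKernel_mul_oneKernel {t : ℝ} (ht : t < 1) (a : ℕ) (σ : ℝ) :
    ∫⁻ τ, oneKernel a t τ * oneKernel 0 τ σ = oneKernel (a + 1) t σ := by
  by_cases hσ : 0 < σ ∧ σ < t
  swap
  · have : ∀ τ, oneKernel a t τ * oneKernel 0 τ σ = 0 := by
      intro τ
      simp only [oneKernel]
      split_ifs with h1 h2
      · exact absurd ⟨h2.1, h2.2.trans h1.2⟩ hσ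
      all_goals simp
    rw [lintegral_congr this, lintegral_zero, oneKernel, if_neg hσ]
  obtain ⟨h0, h1⟩ := hσ
  have hs1 : 0 < 1 - σ := by linarith
  have ht1 : 0 < 1 - t := by linarith
  have hker : ∀ τ, oneKernel a t τ * oneKernel 0 τ σ = (Ioo σ t).indicator
      (fun τ => ENNReal.ofReal
        (Real.log ((1 - τ) / (1 - t)) ^ a / (a ! : ℝ) / (1 - τ) * (1 / (1 - σ)))) τ := by
    intro τ
    by_cases hτ : σ < τ ∧ τ < t
    · rw [indicator_of_mem (by exact hτ), oneKernel, oneKernel_zero, if_pos ⟨by linarith, hτ.2⟩,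
        if_pos ⟨h0, hτ.1⟩, ENNReal.ofReal_mul']
      positivity
    · rw [indicator_of_notMem (by exact hτ), oneKernel, oneKernel_zero]
      split_ifs with h2 h3
      · exact absurd ⟨h3.2, h2.2⟩ hτ
      all_goals simp
  have hderiv : ∀ τ ∈ uIcc σ t, HasDerivAt
      (fun τ => -(Real.log ((1 - τ) / (1 - t)) ^ (a + 1) / ((a + 1)! : ℝ) * (1 / (1 - σ))))
      (Real.log ((1 - τ) / (1 - t)) ^ a / (a ! : ℝ) / (1 - τ) * (1 / (1 - σ))) τ := by
    intro τ hτ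
    rw [uIcc_of_le h1.le] at hτ
    have hτ1 : 0 < 1 - τ := by linarith [hτ.2]
    have := ((((((hasDerivAt_id τ).const_sub 1).div_const (1 - t)).log
      (by simp only [id]; positivity)).pow (a + 1)).div_const ((a + 1)! : ℝ)).mul_const
      (1 / (1 - σ))
    refine this.neg.congr_deriv ?_
    simp only [id, Nat.factorial_succ]
    push_cast
    field_simp
  have hcont : ContinuousOn (fun τ =>
      Real.log ((1 - τ) / (1 - t)) ^ a / (a ! : ℝ) / (1 - τ) * (1 / (1 - σ))) (uIcc σ t) := by
    rw [uIcc_of_le h1.le]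
    have h2 : ∀ τ ∈ Icc σ t, (1 - τ) ≠ 0 := fun τ hτ => by
      have := hτ.2
      intro h; linarith
    have h3 : ∀ τ ∈ Icc σ t, (1 - τ) / (1 - t) ≠ 0 := fun τ hτ => div_ne_zero (h2 τ hτ) ht1.ne'
    fun_prop (disch := assumption)
  have hint := hcont.intervalIntegrable (μ := volume)
  have key := intervalIntegral.integral_eq_sub_of_hasDerivAt hderiv hint
  simp only [hker]
  rw [lintegral_indicator measurableSet_Ioo, restrict_Ioo_eq_restrict_Ioc,
    ← ofReal_integral_eq_lintegral_ofReal, ← intervalIntegral.integral_of_le h1.le, key, oneKernel,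
    if_pos ⟨h0, h1⟩]
  · rw [div_self ht1.ne']
    simp [div_eq_mul_inv]
  · exact (intervalIntegrable_iff_integrableOn_Ioc_of_le h1.le).1 hint
  · filter_upwards [self_mem_ae_restrict measurableSet_Ioc] with τ hτ
    have h2 : 0 < 1 - τ := by linarith [hτ.2]
    have h3 : 0 ≤ Real.log ((1 - τ) / (1 - t)) :=
      Real.log_nonneg ((one_le_div ht1).2 (by linarith [hτ.2]))
    simp only [Pi.zero_apply]
    positivity

end Ohno

/-! ### The nested sum as a recursion, and its integral representation. -/

namespace Ohno

open MeasureTheory Set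
open scoped ENNReal Nat

/-- `∑_{n > m} ∫_{y > 0} e^{-ny} Q n (f (· + y)) dy`. -/
noncomputable def oneStep (Q : ℕ → (ℝ → ℝ≥0∞) → ℝ≥0∞) (m : ℕ) (f : ℝ → ℝ≥0∞) : ℝ≥0∞ :=
  ∑' n : Ioi m, ∫⁻ y in Ioi (0 : ℝ), ENNReal.ofReal (Real.exp (-(n * y))) * Q n fun z => f (z + y)

/-- `n^{-c} Q n f`. -/
noncomputable def divPow (c : ℕ) (Q : ℕ → (ℝ → ℝ≥0∞) → ℝ≥0∞) (n : ℕ) (f : ℝ → ℝ≥0∞) : ℝ≥0∞ :=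
  ENNReal.ofReal (((n : ℝ) ^ c)⁻¹) * Q n f

/-- The sum, over `m < n₁ < ⋯ < n_r`, of
`∏ n_j^{-(k_j - 1)} ∫_{x ∈ (0,∞)^r} f (∑ x_j) e^{-∑ n_j x_j} dx`. -/
noncomputable def tailSum : List ℕ → ℕ → (ℝ → ℝ≥0∞) → ℝ≥0∞
  | [], _, f => f 0
  | k :: l, m, f => oneStep (divPow (k - 1) (tailSum l)) m f

lemma divPow_zero (Q : ℕ → (ℝ → ℝ≥0∞) → ℝ≥0∞) : divPow 0 Q = Q := by
  ext n f
  simp [divPow]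

/-- An entry equal to `1` has no power left to divide by, so each of the `c` ones contributes a bare
`oneStep`. -/
lemma tailSum_replicate_append (c b : ℕ) (l : List ℕ) :
    tailSum (List.replicate c 1 ++ [b + 1] ++ l) = oneStep^[c + 1] (divPow b (tailSum l)) := by
  induction c with
  | zero => ext m f; simp [tailSum]
  | succ c ih =>
    rw [Function.iterate_succ_apply', ← ih]
    ext m f
    simp [List.replicate_succ, tailSum, divPow_zero]

/-- The functional `Q` is given by integration of `τ^m f(u)` against the density `w`,
for `m ≥ N`. -/
def Represents {X : Type*} [MeasurableSpace X] (N : ℕ) (ρ : Measure X) (w : X → ℝ≥0∞)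
    (τ u : X → ℝ) (Q : ℕ → (ℝ → ℝ≥0∞) → ℝ≥0∞) : Prop :=
  ∀ m, N ≤ m → ∀ f, Measurable f →
    Q m f = ∫⁻ x, w x * (ENNReal.ofReal (τ x ^ m) * f (u x)) ∂ρ

section

variable {X : Type*} [MeasurableSpace X] {ρ : Measure X} {w : X → ℝ≥0∞} {τ u : X → ℝ}
  {Q : ℕ → (ℝ → ℝ≥0∞) → ℝ≥0∞}

/-- The threshold rises from `0` to `1` because the kernel integral needs a positive exponent. The
next `oneStep` uses only `n > m ≥ 0`, so it restores the threshold `0`. -/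
lemma Represents.divPow (hQ : Represents 0 ρ w τ u Q) (hw : Measurable w)
    (hτ : Measurable τ) (hu : Measurable u) (hpos : ∀ x, w x ≠ 0 → 0 < τ x) (b : ℕ) :
    Represents 1 (ρ.prod volume) (fun p => w p.1 * zeroKernel b (τ p.1) p.2) (fun p => p.2)
      (fun p => u p.1) (divPow (b + 1) Q) := by
  intro m hm f hf
  have hk : Measurable fun p : X × ℝ => zeroKernel b (τ p.1) p.2 :=
    Measurable.zeroKernel b (by fun_prop) (by fun_prop)
  rw [Ohno.divPow, hQ m (Nat.zero_le _) f hf, lintegral_prod _ (by fun_prop),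
    ← lintegral_const_mul _ (by fun_prop)]
  refine lintegral_congr fun x => ?_
  by_cases hx : w x = 0
  · simp [hx]
  have hkx : Measurable fun y : ℝ => zeroKernel b (τ x) y :=
    Measurable.zeroKernel b measurable_const measurable_id
  have : ∀ y : ℝ, w x * zeroKernel b (τ x) y * (ENNReal.ofReal (y ^ m) * f (u x)) =
      w x * f (u x) * (zeroKernel b (τ x) y * ENNReal.ofReal (y ^ m)) := fun y => by ring
  simp only [this]
  rw [lintegral_const_mul _ (by fun_prop), lintegral_zeroKernel_mul_pow (hpos x hx) b hm]
  ring

variable [SFinite ρ]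

lemma Represents.oneStep {N : ℕ} (hN : N ≤ 1) (hQ : Represents N ρ w τ u Q) (hw : Measurable w)
    (hτ : Measurable τ) (hu : Measurable u) (hpos : ∀ x, w x ≠ 0 → 0 < τ x ∧ τ x < 1) :
    Represents 0 (ρ.prod volume) (fun p => w p.1 * oneKernel 0 (τ p.1) p.2) (fun p => p.2)
      (fun p => u p.1 + Real.log (τ p.1 / p.2)) (oneStep Q) := by
  intro m _ f hf
  have hk : Measurable fun p : X × ℝ => oneKernel 0 (τ p.1) p.2 :=
    Measurable.oneKernel 0 (by fun_prop) (by fun_prop)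
  have h1 : ∀ n : Ioi m, ∫⁻ y in Ioi (0 : ℝ),
      ENNReal.ofReal (Real.exp (-(n * y))) * Q n (fun z => f (z + y)) =
      ∫⁻ x, (∫⁻ y in Ioi (0 : ℝ), ENNReal.ofReal (Real.exp (-(n * y))) *
        (w x * (ENNReal.ofReal (τ x ^ (n : ℕ)) * f (u x + y)))) ∂ρ := by
    intro n
    have hn : 1 ≤ (n : ℕ) := Nat.one_le_of_lt n.2
    rw [lintegral_lintegral_swap (by unfold Function.uncurry; fun_prop)]
    refine lintegral_congr fun y => ?_
    rw [hQ n (hN.trans hn) _ (by fun_prop), lintegral_const_mul _ (by fun_prop)]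
  rw [Ohno.oneStep, tsum_congr h1, ← lintegral_tsum, lintegral_prod _ (by fun_prop)]
  · refine lintegral_congr fun x => ?_
    by_cases hx : w x = 0
    · simp [hx]
    have h2 : ∀ (n : Ioi m) (y : ℝ), ENNReal.ofReal (Real.exp (-(n * y))) *
        (w x * (ENNReal.ofReal (τ x ^ (n : ℕ)) * f (u x + y))) =
        w x * (ENNReal.ofReal (Real.exp (-(n * y))) *
          (ENNReal.ofReal (τ x ^ (n : ℕ)) * f (u x + y))) := fun n y => by ring
    have hkx : Measurable fun y : ℝ => oneKernel 0 (τ x) y :=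
      Measurable.oneKernel 0 measurable_const measurable_id
    have h3 : ∀ n : Ioi m, ∫⁻ y in Ioi (0 : ℝ), w x * (ENNReal.ofReal (Real.exp (-(n * y))) *
        (ENNReal.ofReal (τ x ^ (n : ℕ)) * f (u x + y))) =
        w x * ∫⁻ y in Ioi (0 : ℝ), ENNReal.ofReal (Real.exp (-(n * y))) *
        (ENNReal.ofReal (τ x ^ (n : ℕ)) * f (u x + y)) := fun n =>
      lintegral_const_mul _ (by fun_prop)
    simp only [h2, h3]
    rw [ENNReal.tsum_mul_left, tsum_lintegral_exp_mul (hpos x hx).1 (hpos x hx).2.le m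
      (h := fun y => f (u x + y)) (by fun_prop), ← lintegral_const_mul _ (by fun_prop)]
    refine lintegral_congr fun y => ?_
    ring
  · intro n
    refine Measurable.aemeasurable ?_
    refine Measurable.lintegral_prod_right' (f := fun p : X × ℝ =>
      ENNReal.ofReal (Real.exp (-(n * p.2))) *
        (w p.1 * (ENNReal.ofReal (τ p.1 ^ (n : ℕ)) * f (u p.1 + p.2)))) ?_
    fun_prop

/-- The logarithms telescope, `log (τ/t) + log (t/σ) = log (τ/σ)`, so `f` does not see the
intermediate variable `t`, which integrates out by `lintegral_oneKernel_mul_oneKernel`. -/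
lemma Represents.iterate_oneStep (hQ : Represents 1 ρ w τ u Q) (hw : Measurable w)
    (hτ : Measurable τ) (hu : Measurable u) (hpos : ∀ x, w x ≠ 0 → 0 < τ x ∧ τ x < 1) (a : ℕ) :
    Represents 0 (ρ.prod volume) (fun p => w p.1 * oneKernel a (τ p.1) p.2) (fun p => p.2)
      (fun p => u p.1 + Real.log (τ p.1 / p.2)) (Ohno.oneStep^[a + 1] Q) := by
  induction a with
  | zero => exact hQ.oneStep le_rfl hw hτ hu hpos
  | succ a ih =>
    have hk : ∀ a, Measurable fun p : X × ℝ => oneKernel a (τ p.1) p.2 := fun a =>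
      Measurable.oneKernel a (by fun_prop) (by fun_prop)
    have hk' : Measurable fun p : (X × ℝ) × ℝ => oneKernel 0 p.1.2 p.2 :=
      Measurable.oneKernel 0 (by fun_prop) (by fun_prop)
    have hk1 := hk a
    have hk2 := hk (a + 1)
    have hk3 : Measurable fun p : (X × ℝ) × ℝ => oneKernel a (τ p.1.1) p.1.2 :=
      hk1.comp measurable_fst
    have h := ih.oneStep zero_le_one (by fun_prop) (by fun_prop) (by fun_prop) (by
      intro p hp
      obtain ⟨hp1, hp2⟩ := mul_ne_zero_iff.1 hp
      have hp3 := hpos _ hp1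
      unfold oneKernel at hp2
      split_ifs at hp2 with h0
      · exact ⟨h0.1, h0.2.trans hp3.2⟩
      · exact absurd rfl hp2)
    rw [Function.iterate_succ_apply']
    intro m hm f hf
    have hmeas : Measurable fun p : X × ℝ => ∫⁻ σ : ℝ,
        w p.1 * oneKernel a (τ p.1) p.2 * oneKernel 0 p.2 σ * (ENNReal.ofReal (σ ^ m) *
          f (u p.1 + Real.log (τ p.1 / p.2) + Real.log (p.2 / σ))) := by
      refine Measurable.lintegral_prod_right' (f := fun p : (X × ℝ) × ℝ =>
        w p.1.1 * oneKernel a (τ p.1.1) p.1.2 * oneKernel 0 p.1.2 p.2 * (ENNReal.ofReal (p.2 ^ m) *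
          f (u p.1.1 + Real.log (τ p.1.1 / p.1.2) + Real.log (p.1.2 / p.2)))) ?_
      fun_prop
    rw [h m hm f hf, lintegral_prod _ (by fun_prop), lintegral_prod _ hmeas.aemeasurable,
      lintegral_prod _ (by fun_prop)]
    refine lintegral_congr fun x => ?_
    by_cases hx : w x = 0
    · simp [hx]
    have hkx : ∀ a, Measurable fun y : ℝ => oneKernel a (τ x) y := fun a =>
      Measurable.oneKernel a measurable_const measurable_id
    have hkx1 := hkx a
    have hkx2 : Measurable fun p : ℝ × ℝ => oneKernel a (τ x) p.1 :=
      Measurable.oneKernel a measurable_const measurable_fst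
    have hkx3 : Measurable fun p : ℝ × ℝ => oneKernel 0 p.1 p.2 :=
      measurable_uncurry_oneKernel 0
    have hτx := (hpos x hx).1
    have h1 : ∀ t σ : ℝ, w x * oneKernel a (τ x) t * oneKernel 0 t σ * (ENNReal.ofReal (σ ^ m) *
        f (u x + Real.log (τ x / t) + Real.log (t / σ))) =
        w x * (ENNReal.ofReal (σ ^ m) * f (u x + Real.log (τ x / σ))) *
          (oneKernel a (τ x) t * oneKernel 0 t σ) := by
      intro t σ
      by_cases hk : 0 < σ ∧ σ < t
      · have hσ := hk.1
        have ht := hσ.trans hk.2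
        have : Real.log (τ x / t) + Real.log (t / σ) = Real.log (τ x / σ) := by
          rw [← Real.log_mul (by positivity) (by positivity)]
          congr 1
          field_simp
        rw [add_assoc, this]
        ring
      · simp [oneKernel, hk]
    simp only [h1]
    rw [lintegral_lintegral_swap (by unfold Function.uncurry; fun_prop)]
    refine lintegral_congr fun σ => ?_
    have hkσ : Measurable fun t : ℝ => oneKernel 0 t σ :=
      Measurable.oneKernel 0 measurable_id measurable_const
    rw [lintegral_const_mul _ (by fun_prop),
      lintegral_oneKernel_mul_oneKernel (hpos x hx).2]
    ring

lemma Represents.block {l : List ℕ} (hQ : Represents 0 ρ w τ u (tailSum l)) (hw : Measurable w)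
    (hτ : Measurable τ) (hu : Measurable u) (hpos : ∀ x, w x ≠ 0 → 0 < τ x ∧ τ x ≤ 1)
    (a b : ℕ) :
    Represents 0 ((ρ.prod volume).prod volume)
      (fun p => w p.1.1 * zeroKernel b (τ p.1.1) p.1.2 * oneKernel a p.1.2 p.2) (fun p => p.2)
      (fun p => u p.1.1 + Real.log (p.1.2 / p.2))
      (tailSum (List.replicate a 1 ++ [b + 1 + 1] ++ l)) := by
  rw [tailSum_replicate_append]
  have hk : Measurable fun p : X × ℝ => zeroKernel b (τ p.1) p.2 :=
    Measurable.zeroKernel b (by fun_prop) (by fun_prop)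
  refine (hQ.divPow hw hτ hu (fun x hx => (hpos x hx).1) b).iterate_oneStep (by fun_prop)
    (by fun_prop) (by fun_prop) ?_ a
  intro p hp
  obtain ⟨hp1, hp2⟩ := mul_ne_zero_iff.1 hp
  unfold zeroKernel at hp2
  split_ifs at hp2 with h0
  · exact ⟨h0.1, h0.2.trans_le (hpos _ hp1).2⟩
  · exact absurd rfl hp2

end

end Ohno

/-! ### Coordinates on the simplex and the block integral. -/

namespace Ohno

open MeasureTheory Set
open scoped ENNReal Nat

lemma coord_cons_one {m : ℕ} (x : ℝ) (t : Fin m → ℝ) :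
    coord (Fin.cons x t : Fin (m + 1) → ℝ) 1 = x := by
  simp only [coord, Nat.sub_self, Nat.zero_lt_succ, dite_true]
  exact Fin.cons_zero (α := fun _ => ℝ) _ _

lemma coord_cons_add_two {m : ℕ} (x : ℝ) (t : Fin m → ℝ) (n : ℕ) :
    coord (Fin.cons x t : Fin (m + 1) → ℝ) (n + 2) = coord t (n + 1) := by
  simp only [coord, Nat.add_sub_cancel, show n + 2 - 1 = n + 1 by omega, Nat.add_lt_add_iff_right]
  split_ifs with h
  · exact Fin.cons_succ (α := fun _ => ℝ) x t ⟨n, h⟩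
  · rfl

@[fun_prop]
lemma measurable_coord {m : ℕ} (n : ℕ) : Measurable fun t : Fin m → ℝ => coord t n := by
  unfold coord
  split_ifs
  · exact measurable_pi_apply _
  · exact measurable_const

lemma measurableSet_orderedSimplex (m : ℕ) : MeasurableSet (orderedSimplex m) := by
  have : orderedSimplex m = (⋂ j, {t | t j ∈ Ioo (0 : ℝ) 1}) ∩
      ⋂ i, ⋂ j, {t : Fin m → ℝ | i < j → t i < t j} := by
    ext t
    simp [orderedSimplex, StrictMono]
  rw [this]
  refine (MeasurableSet.iInter fun j => measurableSet_Ioo.preimage (measurable_pi_apply j)).inter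
    (MeasurableSet.iInter fun i => MeasurableSet.iInter fun j => ?_)
  by_cases h : i < j
  · simpa [h] using measurableSet_lt (measurable_pi_apply i) (measurable_pi_apply j)
  · simp [h]

lemma cons_mem_orderedSimplex {m : ℕ} (x : ℝ) (t : Fin m → ℝ) :
    (Fin.cons x t : Fin (m + 1) → ℝ) ∈ orderedSimplex (m + 1) ↔
      (0 < x ∧ x < coord t 1) ∧ t ∈ orderedSimplex m := by
  cases m with
  | zero =>
    simp [orderedSimplex, coord, Subsingleton.strictMono]
  | succ m =>
    simp only [orderedSimplex, mem_ofPred_eq, Fin.strictMono_iff_lt_succ, coord]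
    rw [Fin.forall_fin_succ (P := fun j => (Fin.cons x t : Fin (m + 1 + 1) → ℝ) j ∈ Ioo 0 1),
      Fin.forall_fin_succ (P := fun j : Fin (m + 1) =>
        (Fin.cons x t : Fin (m + 1 + 1) → ℝ) j.castSucc <
        (Fin.cons x t : Fin (m + 1 + 1) → ℝ) j.succ)]
    simp only [Fin.castSucc_zero, Fin.cons_zero, Fin.cons_succ, ← Fin.succ_castSucc, Nat.sub_self,
      Nat.zero_lt_succ, dite_true, Fin.mk_zero, mem_Ioo]
    constructor
    · rintro ⟨⟨h1, h2⟩, h3, h4⟩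
      exact ⟨⟨h1.1, h3⟩, h2, h4⟩
    · rintro ⟨⟨h1, h2⟩, h3, h4⟩
      exact ⟨⟨⟨h1, h2.trans (h3 0).2⟩, h3⟩, h2, h4⟩

lemma coord_pos {m : ℕ} {t : Fin m → ℝ} (ht : t ∈ orderedSimplex m) (n : ℕ) : 0 < coord t n := by
  unfold coord
  split_ifs with h
  · exact (ht.1 _).1
  · exact one_pos

lemma coord_le_one {m : ℕ} {t : Fin m → ℝ} (ht : t ∈ orderedSimplex m) (n : ℕ) :
    coord t n ≤ 1 := by
  unfold coord
  split_ifs with h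
  · exact (ht.1 _).2.le
  · exact le_rfl

lemma measurePreserving_cons (n : ℕ) :
    MeasurePreserving (fun p : (Fin n → ℝ) × ℝ => (Fin.cons p.2 p.1 : Fin (n + 1) → ℝ))
      (volume.prod volume) volume := by
  have h := (volume_preserving_piFinSuccAbove (fun _ : Fin (n + 1) => ℝ) 0).symm.comp
    (Measure.measurePreserving_swap (μ := (volume : Measure (Fin n → ℝ)))
      (ν := (volume : Measure ℝ)))
  convert h using 2 with p
  · rfl
  · exact (Fin.insertNth_zero' (β := ℝ) _ _).symm

lemma measurePreserving_cons_cons (n : ℕ) :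
    MeasurePreserving (fun p : ((Fin n → ℝ) × ℝ) × ℝ =>
      (Fin.cons p.2 (Fin.cons p.1.2 p.1.1 : Fin (n + 1) → ℝ) : Fin (n + 1 + 1) → ℝ))
      ((volume.prod volume).prod volume) volume :=
  (measurePreserving_cons (n + 1)).comp
    ((measurePreserving_cons n).prod (MeasurePreserving.id (volume : Measure ℝ)))

/-- `∏_l (log ((1-t_{2l-1})/(1-t_{2l})))^{a_l-1} (log (t_{2l+1}/t_{2l}))^{b_l-1}
  / ((1-t_{2l-1}) t_{2l})`. -/
noncomputable def blockDensity {d : ℕ} (a b : Fin d → ℕ) (t : Fin (2 * d) → ℝ) : ℝ :=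
  ∏ i : Fin d,
      1 / ((1 - coord t (2 * i + 1)) * coord t (2 * i + 2)) *
        Real.log ((1 - coord t (2 * i + 1)) / (1 - coord t (2 * i + 2))) ^ (a i - 1) *
        Real.log (coord t (2 * i + 3) / coord t (2 * i + 2)) ^ (b i - 1)

/-- `log (t₂ t₄ ⋯ t_{2d} / (t₁ t₃ ⋯ t_{2d-1}))`. -/
noncomputable def logRatio {d : ℕ} (t : Fin (2 * d) → ℝ) : ℝ :=
  Real.log ((∏ i : Fin d, coord t (2 * i + 2)) / ∏ i : Fin d, coord t (2 * i + 1))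

/-- `∏ (a_l - 1)! (b_l - 1)!`. -/
def blockFactorial {d : ℕ} (a b : Fin d → ℕ) : ℕ := ∏ i, ((a i - 1)! * (b i - 1)!)

lemma blockFactorial_pos {d : ℕ} (a b : Fin d → ℕ) : 0 < blockFactorial a b :=
  Finset.prod_pos fun i _ => by positivity

/-- The density of the block integral, normalised by the factorials and supported on the simplex. -/
noncomputable def blockWeight {d : ℕ} (a b : Fin d → ℕ) : (Fin (2 * d) → ℝ) → ℝ≥0∞ :=
  (orderedSimplex (2 * d)).indicator fun t =>
    ENNReal.ofReal (blockDensity a b t / blockFactorial a b)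

@[fun_prop]
lemma measurable_blockDensity {d : ℕ} (a b : Fin d → ℕ) : Measurable (blockDensity a b) := by
  unfold blockDensity
  fun_prop

@[fun_prop]
lemma measurable_logRatio {d : ℕ} : Measurable (logRatio (d := d)) := by
  unfold logRatio
  fun_prop

@[fun_prop]
lemma measurable_blockWeight {d : ℕ} (a b : Fin d → ℕ) : Measurable (blockWeight a b) :=
  Measurable.indicator (by fun_prop) (measurableSet_orderedSimplex _)

section

variable {d : ℕ} (a b : Fin (d + 1) → ℕ) (x y : ℝ) (t : Fin (2 * d) → ℝ)

lemma blockDensity_cons :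
    blockDensity (d := d + 1) a b (Fin.cons x (Fin.cons y t : Fin (2 * d + 1) → ℝ)) =
      1 / ((1 - x) * y) * Real.log ((1 - x) / (1 - y)) ^ (a 0 - 1) *
        Real.log (coord t 1 / y) ^ (b 0 - 1) *
        blockDensity (fun i => a i.succ) (fun i => b i.succ) t := by
  have h1 : coord (Fin.cons x (Fin.cons y t : Fin (2 * d + 1) → ℝ) : Fin (2 * d + 2) → ℝ) 1 = x :=
    coord_cons_one _ _
  have h2 : coord (Fin.cons x (Fin.cons y t : Fin (2 * d + 1) → ℝ) : Fin (2 * d + 2) → ℝ) 2 = y :=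
    (coord_cons_add_two _ _ 0).trans (coord_cons_one _ _)
  have h3 : ∀ n, coord (Fin.cons x (Fin.cons y t : Fin (2 * d + 1) → ℝ) : Fin (2 * d + 2) → ℝ)
      (n + 3) = coord t (n + 1) := fun n =>
    (coord_cons_add_two _ _ (n + 1)).trans (coord_cons_add_two _ _ n)
  unfold blockDensity
  rw [Fin.prod_univ_succ]
  congr 1
  · have h4 := h3 0
    simp only [Nat.zero_add] at h4
    simp only [Fin.val_zero, Nat.mul_zero, Nat.zero_add]
    erw [h1, h2, h4]
  · refine Finset.prod_congr rfl fun i _ => ?_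
    simp only [Fin.val_succ]
    have e1 : 2 * ((i : ℕ) + 1) + 1 = 2 * i + 3 := by ring
    have e2 : 2 * ((i : ℕ) + 1) + 2 = (2 * i + 1) + 3 := by ring
    have e3 : 2 * ((i : ℕ) + 1) + 3 = (2 * i + 2) + 3 := by ring
    rw [e1, e2, e3]
    erw [h3, h3, h3]

lemma logRatio_cons (hx : 0 < x) (hy : 0 < y) (ht : t ∈ orderedSimplex (2 * d)) :
    logRatio (d := d + 1) (Fin.cons x (Fin.cons y t : Fin (2 * d + 1) → ℝ)) =
      logRatio t + Real.log (y / x) := by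
  have h1 : coord (Fin.cons x (Fin.cons y t : Fin (2 * d + 1) → ℝ) : Fin (2 * d + 2) → ℝ) 1 = x :=
    coord_cons_one _ _
  have h2 : coord (Fin.cons x (Fin.cons y t : Fin (2 * d + 1) → ℝ) : Fin (2 * d + 2) → ℝ) 2 = y :=
    (coord_cons_add_two _ _ 0).trans (coord_cons_one _ _)
  have h3 : ∀ n, coord (Fin.cons x (Fin.cons y t : Fin (2 * d + 1) → ℝ) : Fin (2 * d + 2) → ℝ)
      (n + 3) = coord t (n + 1) := fun n =>
    (coord_cons_add_two _ _ (n + 1)).trans (coord_cons_add_two _ _ n)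
  unfold logRatio
  rw [Fin.prod_univ_succ, Fin.prod_univ_succ]
  have p1 : 0 < ∏ i : Fin d, coord t (2 * i + 2) := Finset.prod_pos fun i _ => coord_pos ht _
  have p2 : 0 < ∏ i : Fin d, coord t (2 * i + 1) := Finset.prod_pos fun i _ => coord_pos ht _
  rw [← Real.log_mul (by positivity) (by positivity)]
  have e1 : ∀ i : Fin d, 2 * (i.succ : ℕ) + 1 = 2 * i + 3 := fun i => by
    simp only [Fin.val_succ]; ring
  have e2 : ∀ i : Fin d, 2 * (i.succ : ℕ) + 2 = (2 * i + 1) + 3 := fun i => by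
    simp only [Fin.val_succ]; ring
  simp only [e1, e2, Fin.val_zero, Nat.mul_zero, Nat.zero_add]
  erw [h1, h2, Finset.prod_congr rfl fun (i : Fin d) _ => h3 (2 * i),
    Finset.prod_congr rfl fun (i : Fin d) _ => h3 (2 * i + 1)]
  congr 1
  field_simp

lemma blockDensity_nonneg {d : ℕ} (a b : Fin d → ℕ) {t : Fin (2 * d) → ℝ}
    (ht : t ∈ orderedSimplex (2 * d)) : 0 ≤ blockDensity a b t := by
  -- Monotonicity must include the convention `t_{2d+1} = 1`, which enters the last logarithm.
  have hmono : ∀ m n, m ≤ n → coord t (m + 1) ≤ coord t (n + 1) := by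
    intro m n hmn
    simp only [coord, Nat.add_sub_cancel]
    split_ifs with h1 h2 h2
    · exact ht.2.monotone hmn
    · exact (ht.1 _).2.le
    · omega
    · exact le_rfl
  refine Finset.prod_nonneg fun i _ => ?_
  have h0 := coord_le_one ht (2 * i + 1)
  have h1 : coord t (2 * i + 2) < 1 := by
    have hi : 2 * (i : ℕ) + 1 < 2 * d := by omega
    rw [coord, dif_pos (by omega)]
    exact (ht.1 _).2
  have h2 := coord_pos ht (2 * i + 2)
  have h3 := hmono (2 * i) (2 * i + 1) (by omega)
  have h4 := hmono (2 * i + 1) (2 * i + 2) (by omega)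
  have h5 : 0 ≤ Real.log ((1 - coord t (2 * i + 1)) / (1 - coord t (2 * i + 2))) :=
    Real.log_nonneg ((one_le_div (by linarith)).2 (by linarith))
  have h6 : 0 ≤ Real.log (coord t (2 * i + 3) / coord t (2 * i + 2)) :=
    Real.log_nonneg ((one_le_div h2).2 (by linarith))
  have h7 : 0 ≤ 1 - coord t (2 * i + 1) := by linarith
  positivity

lemma blockWeight_cons :
    blockWeight (d := d + 1) a b (Fin.cons x (Fin.cons y t : Fin (2 * d + 1) → ℝ)) =
      blockWeight (fun i => a i.succ) (fun i => b i.succ) t *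
        zeroKernel (b 0 - 1) (coord t 1) y * oneKernel (a 0 - 1) y x := by
  have hmem : (Fin.cons x (Fin.cons y t : Fin (2 * d + 1) → ℝ) : Fin (2 * (d + 1)) → ℝ) ∈
      orderedSimplex (2 * (d + 1)) ↔
      (0 < x ∧ x < y) ∧ (0 < y ∧ y < coord t 1) ∧ t ∈ orderedSimplex (2 * d) := by
    have h := cons_mem_orderedSimplex x (Fin.cons y t : Fin (2 * d + 1) → ℝ)
    rwa [coord_cons_one, cons_mem_orderedSimplex y t] at h
  by_cases h : (0 < x ∧ x < y) ∧ (0 < y ∧ y < coord t 1) ∧ t ∈ orderedSimplex (2 * d)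
  · rw [blockWeight, blockWeight, indicator_of_mem (hmem.2 h), indicator_of_mem h.2.2, zeroKernel,
      if_pos h.2.1, oneKernel, if_pos h.1, blockDensity_cons]
    obtain ⟨⟨h1, h2⟩, ⟨h3, h4⟩, h5⟩ := h
    have h6 := blockDensity_nonneg (fun i => a i.succ) (fun i => b i.succ) h5
    have h7 : 0 ≤ Real.log (coord t 1 / y) := Real.log_nonneg ((one_le_div h3).2 h4.le)
    rw [← ENNReal.ofReal_mul (by positivity), ← ENNReal.ofReal_mul (by positivity)]
    congr 1
    simp only [blockFactorial]
    rw [Fin.prod_univ_succ]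
    push_cast
    rw [one_div, mul_inv]
    simp only [div_eq_mul_inv, mul_inv]
    ring
  · rw [blockWeight, indicator_of_notMem (fun h' => h (hmem.1 h'))]
    symm
    by_contra hne
    obtain ⟨hne, h3⟩ := mul_ne_zero_iff.1 hne
    obtain ⟨h1, h2⟩ := mul_ne_zero_iff.1 hne
    refine h ⟨?_, ?_, ?_⟩
    · by_contra h'; exact h3 (if_neg h')
    · by_contra h'; exact h2 (if_neg h')
    · by_contra h'; exact h1 (indicator_of_notMem h' _)

end

/-- Induction on the number of blocks: a new first block prepends the two smallest variables `t₁ <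
t₂`, with `t₂` from the kernel in `dt/t` and `t₁` from the kernel in `dσ/(1-σ)`. -/
theorem represents_tailSum_blockIndex (d : ℕ) (a b : Fin d → ℕ)
    (hb : ∀ i, 1 ≤ b i) :
    Represents 0 volume (blockWeight a b) (fun t => coord t 1) logRatio
      (tailSum (blockIndex a b)) := by
  induction d with
  | zero =>
    intro m _ f hf
    -- With no blocks the space is a point, where `coord t 1 = 1`, the weight is `1` and `logRatio`
    -- is `log 1 = 0`, matching `f 0`.
    have hv : (volume : Measure (Fin (2 * 0) → ℝ)) = Measure.dirac 0 := by
      have : IsEmpty (Fin (2 * 0)) := inferInstanceAs (IsEmpty (Fin 0))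
      rw [volume_pi]
      exact Measure.pi_of_empty _ _
    have h0 : (0 : Fin (2 * 0) → ℝ) ∈ orderedSimplex (2 * 0) :=
      ⟨fun j => j.elim0, fun j => j.elim0⟩
    rw [hv, lintegral_dirac]
    simp [blockIndex, tailSum, blockWeight, indicator_of_mem h0, blockDensity, blockFactorial,
      logRatio, coord]
  | succ d ih =>
    have hrep := (ih (fun i => a i.succ) (fun i => b i.succ) (fun i => hb _)).block
      (by fun_prop) (by fun_prop) (by fun_prop) (by
        intro t ht
        have hmem : t ∈ orderedSimplex (2 * d) := by
          by_contra h
          exact ht (indicator_of_notMem h _)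
        exact ⟨coord_pos hmem 1, coord_le_one hmem 1⟩) (a 0 - 1) (b 0 - 1)
    have hidx : blockIndex a b = List.replicate (a 0 - 1) 1 ++ [b 0 - 1 + 1 + 1] ++
        blockIndex (fun i => a i.succ) fun i => b i.succ := by
      rw [blockIndex, List.ofFn_succ, List.flatten_cons, Nat.sub_add_cancel (hb 0)]
      rfl
    intro m hm f hf
    rw [hidx, hrep m hm f hf]
    have hmp := (measurePreserving_cons_cons (2 * d)).lintegral_comp
      (f := fun t : Fin (2 * d + 2) → ℝ => blockWeight (d := d + 1) a b t *
        (ENNReal.ofReal (coord t 1 ^ m) * f (logRatio (d := d + 1) t)))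
      ((measurable_blockWeight (d := d + 1) a b).mul
        (((measurable_coord 1).pow_const m).ennreal_ofReal.mul
          (hf.comp (measurable_logRatio (d := d + 1)))))
    refine Eq.trans ?_ hmp
    refine lintegral_congr fun p => ?_
    obtain ⟨⟨t, y⟩, x⟩ := p
    simp only [coord_cons_one]
    rw [blockWeight_cons]
    by_cases h : blockWeight (fun i => a i.succ) (fun i => b i.succ) t *
        zeroKernel (b 0 - 1) (coord t 1) y * oneKernel (a 0 - 1) y x = 0
    · simp only [h, zero_mul]
    · obtain ⟨h1, h3⟩ := mul_ne_zero_iff.1 h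
      obtain ⟨h1, h2⟩ := mul_ne_zero_iff.1 h1
      rw [logRatio_cons]
      · by_contra h'; exact h3 (if_neg fun h4 => h' h4.1)
      · by_contra h'; exact h2 (if_neg fun h4 => h' h4.1)
      · by_contra h'; exact h1 (indicator_of_notMem h' _)

end Ohno

/-! ### Unfolding the recursion into a sum over tuples; convolution of exponentials. -/

namespace Ohno

open MeasureTheory Set
open scoped ENNReal Nat

/-- `∫_{x ∈ (0,∞)^r} f (∑ x_j) e^{-∑ n_j x_j} dx` as an iterated integral. -/
noncomputable def expIter : (r : ℕ) → (Fin r → ℕ) → (ℝ → ℝ≥0∞) → ℝ≥0∞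
  | 0, _, f => f 0
  | r + 1, n, f => ∫⁻ y in Ioi (0 : ℝ),
      ENNReal.ofReal (Real.exp (-(n 0 * y))) * expIter r (Fin.tail n) fun z => f (z + y)

/-- The parameter space is arbitrary because the induction passes from `α` to `α × ℝ`, treating the
shift as a further parameter. -/
lemma measurable_expIter {α : Type} [MeasurableSpace α] (r : ℕ) (n : Fin r → ℕ)
    {F : α × ℝ → ℝ≥0∞} (hF : Measurable F) :
    Measurable fun x => expIter r n fun z => F (x, z) := by
  induction r generalizing α with
  | zero => exact hF.comp (by fun_prop)
  | succ r ih =>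
    have h := ih (Fin.tail n) (F := fun p : (α × ℝ) × ℝ => F (p.1.1, p.2 + p.1.2))
      (hF.comp (by fun_prop))
    refine Measurable.lintegral_prod_right' (f := fun p : α × ℝ =>
      ENNReal.ofReal (Real.exp (-(n 0 * p.2))) *
        expIter r (Fin.tail n) fun z => F (p.1, z + p.2)) ?_
    fun_prop

/-- The tuples `m < n₁ < ⋯ < n_r`. -/
abbrev tuplesAbove (m r : ℕ) : Type :=
  {n : Fin r → ℕ // (∀ j, m < n j) ∧ StrictMono n}

lemma strictMono_cons_iff {r : ℕ} (n₀ : ℕ) (n : Fin r → ℕ) :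
    StrictMono (Fin.cons n₀ n : Fin (r + 1) → ℕ) ↔ (∀ j, n₀ < n j) ∧ StrictMono n := by
  constructor
  · intro h
    exact ⟨fun j => by simpa using h (Fin.succ_pos j),
      fun i j hij => by simpa using h (Fin.succ_lt_succ_iff.2 hij)⟩
  · rintro ⟨h1, h2⟩ i j hij
    cases i using Fin.cases with
    | zero =>
      cases j using Fin.cases with
      | zero => exact absurd hij (lt_irrefl _)
      | succ j => simpa using h1 j
    | succ i =>
      cases j using Fin.cases with
      | zero => exact absurd hij (Fin.not_lt_zero _)
      | succ j => simpa using h2 (Fin.succ_lt_succ_iff.1 hij)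

/-- Splitting off the smallest entry of a tuple. -/
def tuplesAboveEquiv (m r : ℕ) : (Σ n₀ : Ioi m, tuplesAbove n₀ r) ≃ tuplesAbove m (r + 1) where
  toFun p := ⟨Fin.cons p.1.1 p.2.1, by
    refine ⟨fun j => ?_, (strictMono_cons_iff _ _).2 p.2.2⟩
    cases j using Fin.cases with
    | zero => simp only [Fin.cons_zero]; exact p.1.2
    | succ j => simp only [Fin.cons_succ]; exact lt_trans p.1.2 (p.2.2.1 j)⟩
  invFun n := ⟨⟨n.1 0, n.2.1 0⟩, ⟨Fin.tail n.1, by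
    have h := n.2.2
    rw [← Fin.cons_self_tail n.1, strictMono_cons_iff] at h
    exact h⟩⟩
  left_inv p := by
    obtain ⟨⟨n₀, h₀⟩, ⟨n, hn⟩⟩ := p
    rfl
  right_inv n := Subtype.ext (Fin.cons_self_tail n.1)

theorem tailSum_eq_tsum (l : List ℕ) (m : ℕ) {f : ℝ → ℝ≥0∞} (hf : Measurable f) :
    tailSum l m f = ∑' n : tuplesAbove m l.length,
      ENNReal.ofReal (∏ j, ((n.1 j : ℝ) ^ (l.get j - 1))⁻¹) * expIter l.length n.1 f := by
  induction l generalizing m f with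
  | nil =>
    have : Unique (tuplesAbove m ([] : List ℕ).length) :=
      { default := ⟨fun j => j.elim0, fun j => j.elim0, fun j => j.elim0⟩
        uniq := fun n => Subtype.ext (funext fun j => j.elim0) }
    rw [tsum_eq_single default (fun n hn => absurd (this.uniq n) hn)]
    simp only [tailSum, List.length_nil, Finset.univ_eq_empty, Finset.prod_empty,
      ENNReal.ofReal_one, one_mul]
    rfl
  | cons k l ih =>
    change _ = ∑' n : tuplesAbove m (l.length + 1), _
    rw [← (tuplesAboveEquiv m l.length).tsum_eq, ENNReal.tsum_sigma']
    rw [tailSum, oneStep]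
    refine tsum_congr fun n₀ => ?_
    have h1 : ∀ y : ℝ, ENNReal.ofReal (Real.exp (-(n₀ * y))) *
        divPow (k - 1) (tailSum l) n₀ (fun z => f (z + y)) =
        ∑' n : tuplesAbove n₀ l.length, ENNReal.ofReal ((((n₀ : ℕ) : ℝ) ^ (k - 1))⁻¹ *
          ∏ j, ((n.1 j : ℝ) ^ (l.get j - 1))⁻¹) * (ENNReal.ofReal (Real.exp (-(n₀ * y))) *
          expIter l.length n.1 fun z => f (z + y)) := by
      intro y
      rw [divPow, ih n₀ (by fun_prop), ← ENNReal.tsum_mul_left, ← ENNReal.tsum_mul_left]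
      refine tsum_congr fun n => ?_
      rw [ENNReal.ofReal_mul (by positivity)]
      ring
    have h2 : ∀ n : tuplesAbove n₀ l.length,
        Measurable fun y : ℝ => expIter l.length n.1 fun z => f (z + y) := fun n =>
      measurable_expIter l.length n.1 (F := fun p : ℝ × ℝ => f (p.2 + p.1)) (by fun_prop)
    simp only [h1]
    rw [lintegral_tsum (fun n => by have := h2 n; fun_prop)]
    refine tsum_congr fun n => ?_
    have := h2 n
    rw [lintegral_const_mul _ (by fun_prop)]
    congr 2
    change _ = ∏ j : Fin (l.length + 1), _
    rw [Fin.prod_univ_succ]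
    rfl

/-- The density `∑_i e^{-n_i x} ∏_{j ≠ i} (n_j - n_i)⁻¹` of the convolution of the measures
`e^{-n_j x} dx`. -/
noncomputable def expDensity {r : ℕ} (n : Fin r → ℕ) (x : ℝ) : ℝ :=
  ∑ i, (∏ j ∈ Finset.univ.erase i, ((n j : ℝ) - n i)⁻¹) * Real.exp (-(n i * x))

@[fun_prop]
lemma measurable_expDensity {r : ℕ} (n : Fin r → ℕ) : Measurable (expDensity n) := by
  unfold expDensity
  fun_prop

lemma prod_univ_erase_zero {M : Type*} [CommMonoid M] {r : ℕ} (g : Fin (r + 1) → M) :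
    ∏ j ∈ Finset.univ.erase 0, g j = ∏ j : Fin r, g j.succ := by
  have h : ∏ j ∈ Finset.univ.erase (0 : Fin (r + 1)), g j =
      ∏ j ∈ Finset.univ.erase (0 : Fin (r + 1)), if j = 0 then 1 else g j :=
    Finset.prod_congr rfl fun j hj => by rw [if_neg (Finset.ne_of_mem_erase hj)]
  rw [h, Finset.prod_erase _ (by simp), Fin.prod_univ_succ]
  simp [Fin.succ_ne_zero]

lemma prod_univ_erase_succ {M : Type*} [CommMonoid M] {r : ℕ} (g : Fin (r + 1) → M) (i : Fin r) :
    ∏ j ∈ Finset.univ.erase i.succ, g j = g 0 * ∏ j ∈ Finset.univ.erase i, g j.succ := by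
  have h : ∏ j ∈ Finset.univ.erase i.succ, g j =
      ∏ j ∈ Finset.univ.erase i.succ, if j = i.succ then 1 else g j :=
    Finset.prod_congr rfl fun j hj => by rw [if_neg (Finset.ne_of_mem_erase hj)]
  have h' : ∏ j ∈ Finset.univ.erase i, g j.succ =
      ∏ j ∈ Finset.univ.erase i, if j = i then 1 else g j.succ :=
    Finset.prod_congr rfl fun j hj => by rw [if_neg (Finset.ne_of_mem_erase hj)]
  rw [h, h', Finset.prod_erase _ (by simp), Finset.prod_erase _ (by simp), Fin.prod_univ_succ]
  simp [(Fin.succ_ne_zero i).symm]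

/-- Partial fractions: the Lagrange basis polynomials sum to `1`; evaluate at `x` and divide by the
nodal polynomial. -/
lemma sum_prod_inv_sub_mul_inv_sub {F ι : Type*} [Field F] [Fintype ι] [DecidableEq ι] [Nonempty ι]
    {v : ι → F} (hv : Function.Injective v) {x : F} (hx : ∀ i, x ≠ v i) :
    ∑ i, (∏ j ∈ Finset.univ.erase i, (v i - v j)⁻¹) * (x - v i)⁻¹ = ∏ j, (x - v j)⁻¹ := by
  have h := congrArg (Polynomial.eval x)
    (Lagrange.sum_basis (s := Finset.univ) (v := v) hv.injOn Finset.univ_nonempty)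
  rw [Polynomial.eval_finsetSum, Polynomial.eval_one,
    Finset.sum_congr rfl fun i hi => Lagrange.eval_basis_not_at_node hi (hx i),
    ← Finset.mul_sum, Lagrange.eval_nodal] at h
  rw [Finset.prod_inv_distrib]
  exact eq_inv_of_mul_eq_one_right h

lemma expDensity_succ {r : ℕ} (n : Fin (r + 1 + 1) → ℕ) (hn : Function.Injective n) (z : ℝ) :
    ∫ y in (0 : ℝ)..z, Real.exp (-(n 0 * y)) * expDensity (Fin.tail n) (z - y) =
      expDensity n z := by
  have hne : ∀ i : Fin (r + 1), (n i.succ : ℝ) - n 0 ≠ 0 := fun i => by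
    rw [sub_ne_zero]
    exact_mod_cast fun h => Fin.succ_ne_zero i (hn h)
  set C : Fin (r + 1) → ℝ := fun i =>
    ∏ j ∈ Finset.univ.erase i, ((n j.succ : ℝ) - n i.succ)⁻¹ with hC
  -- At `y = 0` this antiderivative gives the terms in `e^{-n_i z}` with `i > 0`. At `y = z` every
  -- summand is a multiple of `e^{-n_0 z}`, and the partial fraction identity sums the coefficients.
  have hderiv : ∀ y ∈ uIcc 0 z, HasDerivAt
      (fun y => ∑ i : Fin (r + 1), C i * ((n i.succ : ℝ) - n 0)⁻¹ *
        Real.exp (-(n 0 * y) + -(n i.succ * (z - y))))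
      (Real.exp (-(n 0 * y)) * expDensity (Fin.tail n) (z - y)) y := by
    intro y _
    rw [expDensity, Finset.mul_sum]
    refine HasDerivAt.fun_sum fun i _ => ?_
    have h1 : HasDerivAt (fun y : ℝ => -(n 0 * y) + -(n i.succ * (z - y)))
        ((n i.succ : ℝ) - n 0) y := by
      have := (((hasDerivAt_id y).const_mul (n 0 : ℝ)).neg).add
        ((((hasDerivAt_id y).const_sub z).const_mul (n i.succ : ℝ)).neg)
      exact this.congr_deriv (by ring)
    refine (h1.exp.const_mul (C i * ((n i.succ : ℝ) - n 0)⁻¹)).congr_deriv ?_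
    have := hne i
    rw [Real.exp_add]
    simp only [Fin.tail, hC]
    field_simp
  rw [intervalIntegral.integral_eq_sub_of_hasDerivAt hderiv (by
    refine Continuous.intervalIntegrable ?_ _ _
    unfold expDensity
    fun_prop)]
  have hlag := sum_prod_inv_sub_mul_inv_sub (F := ℝ) (v := fun i : Fin (r + 1) => -(n i.succ : ℝ))
    (fun i j h => by
      have : n i.succ = n j.succ := by exact_mod_cast neg_injective h
      exact Fin.succ_injective _ (hn this)) (x := -(n 0 : ℝ))
    (fun i h => hne i (by linarith))
  have e1 : ∀ a b : ℝ, -a - -b = b - a := fun a b => by ring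
  simp only [e1] at hlag
  have hR : expDensity n z =
      (∑ i, C i * ((n i.succ : ℝ) - n 0)⁻¹ * Real.exp (-(n 0 * z))) +
        ∑ i : Fin (r + 1), (∏ j ∈ Finset.univ.erase i.succ, ((n j : ℝ) - n i.succ)⁻¹) *
          Real.exp (-(n i.succ * z)) := by
    rw [expDensity, Fin.sum_univ_succ, prod_univ_erase_zero, ← hlag, Finset.sum_mul]
  rw [hR, sub_eq_add_neg, ← Finset.sum_neg_distrib]
  congr 1
  · refine Finset.sum_congr rfl fun i _ => ?_
    simp [hC]
  · refine Finset.sum_congr rfl fun i _ => ?_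
    rw [prod_univ_erase_succ, ← neg_sub (n i.succ : ℝ) (n 0 : ℝ), inv_neg]
    simp only [hC, mul_zero, neg_zero, zero_add, sub_zero]
    ring

/-- Nonnegativity is not visible from the alternating formula; it is inherited from the convolution,
and is carried in the induction because it turns the Bochner convolution integral into a lower
integral. The depth is at least one since the empty convolution is a point mass at `0`. -/
theorem expIter_eq_lintegral_expDensity {r : ℕ} (n : Fin (r + 1) → ℕ) (hn : Function.Injective n) :
    (∀ x, 0 < x → 0 ≤ expDensity n x) ∧ ∀ f : ℝ → ℝ≥0∞, Measurable f →
      expIter (r + 1) n f = ∫⁻ x in Ioi (0 : ℝ), ENNReal.ofReal (expDensity n x) * f x := by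
  induction r with
  | zero =>
    have h : ∀ x, expDensity n x = Real.exp (-(n 0 * x)) := fun x => by simp [expDensity]
    refine ⟨fun x _ => by rw [h]; positivity, fun f hf => ?_⟩
    simp [expIter, h]
  | succ r ih =>
    obtain ⟨hpos, hint⟩ := ih (Fin.tail n) (hn.comp (Fin.succ_injective _))
    have hpos' : ∀ z, 0 < z → ∀ᵐ y ∂volume.restrict (Ioc 0 z),
        0 ≤ Real.exp (-(n 0 * y)) * expDensity (Fin.tail n) (z - y) := by
      intro z hz
      rw [← restrict_Ioo_eq_restrict_Ioc]
      filter_upwards [self_mem_ae_restrict measurableSet_Ioo] with y hy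
      have := hpos (z - y) (by linarith [hy.2])
      positivity
    refine ⟨fun z hz => ?_, fun f hf => ?_⟩
    · rw [← expDensity_succ n hn, intervalIntegral.integral_of_le hz.le]
      exact integral_nonneg_of_ae (hpos' z hz)
    · have h1 : ∀ y : ℝ, expIter (r + 1) (Fin.tail n) (fun z => f (z + y)) =
          ∫⁻ z, (Ioi y).indicator
            (fun z => ENNReal.ofReal (expDensity (Fin.tail n) (z - y)) * f z) z := by
        intro y
        rw [hint _ (by fun_prop), ← lintegral_indicator measurableSet_Ioi,
          ← lintegral_sub_right_eq_self _ y]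
        refine lintegral_congr fun z => ?_
        simp [indicator, sub_pos]
      have h2 : Measurable fun p : ℝ × ℝ => (Ioi p.1).indicator
          (fun z => ENNReal.ofReal (expDensity (Fin.tail n) (z - p.1)) * f z) p.2 := by
        simp only [indicator, mem_Ioi]
        exact Measurable.ite (measurableSet_lt measurable_fst measurable_snd) (by fun_prop)
          measurable_const
      rw [expIter]
      simp only [h1]
      have h3 : ∀ y : ℝ, ENNReal.ofReal (Real.exp (-(n 0 * y))) * ∫⁻ z, (Ioi y).indicator
            (fun z => ENNReal.ofReal (expDensity (Fin.tail n) (z - y)) * f z) z =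
          ∫⁻ z, ENNReal.ofReal (Real.exp (-(n 0 * y))) * (Ioi y).indicator
            (fun z => ENNReal.ofReal (expDensity (Fin.tail n) (z - y)) * f z) z := fun y =>
        (lintegral_const_mul _ (h2.comp (by fun_prop : Measurable fun z : ℝ => (y, z)))).symm
      simp only [h3]
      rw [lintegral_lintegral_swap (by unfold Function.uncurry; fun_prop),
        ← lintegral_indicator measurableSet_Ioi]
      refine lintegral_congr fun z => ?_
      by_cases hz : 0 < z
      swap
      · rw [indicator_of_notMem (by simpa using hz)]
        rw [setLIntegral_congr_fun (g := fun _ => 0) measurableSet_Ioi, lintegral_zero]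
        intro y hy
        have : z ∉ Ioi y := by
          simp only [mem_Ioi, not_lt] at hy hz ⊢
          linarith [show (0 : ℝ) < y from hy]
        simp only [indicator_of_notMem this, mul_zero]
      · rw [indicator_of_mem (by exact hz), ← expDensity_succ n hn,
          intervalIntegral.integral_of_le hz.le, ofReal_integral_eq_lintegral_ofReal _ (hpos' z hz),
          ← restrict_Ioo_eq_restrict_Ioc, ← lintegral_mul_const _ (by fun_prop),
          ← lintegral_indicator measurableSet_Ioi, ← lintegral_indicator measurableSet_Ioo]
        · refine lintegral_congr fun y => ?_
          by_cases hy : 0 < y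
          swap
          · rw [indicator_of_notMem (by simpa using hy),
              indicator_of_notMem (fun h => hy h.1)]
          rw [indicator_of_mem (by exact hy)]
          by_cases hyz : y < z
          · rw [indicator_of_mem (by exact hyz), indicator_of_mem (by exact ⟨hy, hyz⟩),
              ENNReal.ofReal_mul (by positivity), mul_assoc]
          · rw [indicator_of_notMem (by simpa using hyz), indicator_of_notMem (fun h => hyz h.2),
              mul_zero]
        · have hc : Continuous fun y =>
              Real.exp (-(n 0 * y)) * expDensity (Fin.tail n) (z - y) := by
            unfold expDensity
            fun_prop
          exact (hc.intervalIntegrable 0 z).1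

end Ohno

/-! ### Absolute convergence of the Ohno series. -/

namespace Ohno

lemma summable_prod_pi {r : ℕ} {h : Fin r → ℕ → ℝ} (h0 : ∀ j n, 0 ≤ h j n)
    (hs : ∀ j, Summable (h j)) : Summable fun x : Fin r → ℕ => ∏ j, h j (x j) := by
  induction r with
  | zero => exact Summable.of_finite
  | succ r ih =>
    have h1 := (hs 0).mul_of_nonneg (ih (h := fun j => h j.succ) (fun j => h0 _) fun j => hs _)
      (h0 0) (fun x => Finset.prod_nonneg fun j _ => h0 _ _)
    rw [← (Fin.consEquiv fun _ : Fin (r + 1) => ℕ).summable_iff]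
    refine h1.congr fun p => ?_
    simp [Fin.prod_univ_succ, Fin.consEquiv]

/-- The tuple `n` with each entry `n_j`, `j ≠ i`, replaced by its distance to `n_i`. -/
def distances {r : ℕ} (i : Fin r) (n : Fin r → ℕ) (j : Fin r) : ℕ :=
  if j = i then n i else ((n j : ℤ) - n i).natAbs

/-- Monotonicity fixes the sign of `n_j - n_i`, so nothing is lost in the absolute values. The
series can then be dominated by an unrestricted product of one-variable series. -/
lemma distances_injective {r : ℕ} (i : Fin r) :
    Function.Injective fun n : summationTuples r => distances i n.1 := by
  rintro ⟨n, _, hn⟩ ⟨m, _, hm⟩ h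
  have hi : n i = m i := by simpa [distances] using congrFun h i
  refine Subtype.ext (funext fun j => ?_)
  rcases lt_trichotomy j i with hj | rfl | hj
  · have h1 := congrFun h j
    simp only [distances, if_neg hj.ne] at h1
    have h2 := hn hj
    have h3 := hm hj
    simp only
    omega
  · exact hi
  · have h1 := congrFun h j
    simp only [distances, if_neg hj.ne'] at h1
    have h2 := hn hj
    have h3 := hm hj
    simp only
    omega

lemma norm_ohnoTerm {k : List ℕ} (s : ℂ) (i : Fin k.length) {n : Fin k.length → ℕ}
    (hn : n ∈ summationTuples k.length) :
    ‖ohnoTerm k s i n‖ = (∏ j, (n j : ℝ) ^ k.get j)⁻¹ * ((n i : ℝ) ^ s.re)⁻¹ *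
      ((∏ j ∈ Finset.univ.erase i, (n j : ℝ)) *
        ∏ j ∈ Finset.univ.erase i, (distances i n j : ℝ)⁻¹) := by
  have h1 : ∀ j ∈ Finset.univ.erase i, ‖(n j : ℂ) / ((n j : ℂ) - (n i : ℂ))‖ =
      (n j : ℝ) * (distances i n j : ℝ)⁻¹ := by
    intro j hj
    have h2 : ((n j : ℂ) - (n i : ℂ)) = (((n j : ℤ) - n i : ℤ) : ℂ) := by push_cast; rfl
    rw [norm_div, Complex.norm_natCast, h2, Complex.norm_intCast, distances,
      if_neg (Finset.ne_of_mem_erase hj), div_eq_mul_inv, ← Int.cast_abs, Int.abs_eq_natAbs,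
      Int.cast_natCast]
  rw [ohnoTerm, norm_mul, norm_mul, norm_div, norm_div, norm_one, norm_prod, norm_prod,
    Finset.prod_congr rfl h1, Finset.prod_mul_distrib,
    Complex.norm_natCast_cpow_of_pos (hn.1 i), one_div, one_div]
  simp only [norm_pow, Complex.norm_natCast]

/-- Admissibility leaves a spare factor `1/n_L`. Part of it pays for raising each `1/d_j` to
`d_j^{-(1+ε)}`, using `d_j ≤ n_L`; the rest is traded for a power of `n_i ≤ n_L`. -/
lemma norm_ohnoTerm_le {k : List ℕ} (hk : ∀ j, 1 ≤ k.get j) {L : Fin k.length}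
    (hL : ∀ j, j ≤ L) (hkL : 2 ≤ k.get L) (s : ℂ) {ε : ℝ} (hε : 0 ≤ ε)
    (hε' : ε * k.length ≤ 1) (i : Fin k.length) {n : Fin k.length → ℕ}
    (hn : n ∈ summationTuples k.length) :
    ‖ohnoTerm k s i n‖ ≤ (n i : ℝ) ^ (-(2 + s.re - ε * k.length)) *
      ∏ j ∈ Finset.univ.erase i, (distances i n j : ℝ) ^ (-(1 + ε)) := by
  have hpos : ∀ j, (1 : ℝ) ≤ n j := fun j => by exact_mod_cast hn.1 j
  have hpos' : ∀ j, (0 : ℝ) < n j := fun j => zero_lt_one.trans_le (hpos j)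
  have hdpos : ∀ j, (0 : ℝ) < distances i n j := by
    intro j
    have : 0 < distances i n j := by
      unfold distances
      split_ifs with h
      · exact hn.1 i
      · have := hn.2.injective.ne h
        omega
    exact_mod_cast this
  have hdle : ∀ j, (distances i n j : ℝ) ≤ n L := by
    intro j
    have h1 := hn.2.monotone (hL j)
    have h2 := hn.2.monotone (hL i)
    have : distances i n j ≤ n L := by
      unfold distances
      split_ifs with h
      · exact h2
      · omega
    exact_mod_cast this
  have hprod : (n L : ℝ) * (n i * ∏ j ∈ Finset.univ.erase i, (n j : ℝ)) ≤
      ∏ j, (n j : ℝ) ^ k.get j := by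
    rw [Finset.mul_prod_erase Finset.univ (fun j => (n j : ℝ)) (Finset.mem_univ i),
      ← Finset.mul_prod_erase Finset.univ (fun j => (n j : ℝ)) (Finset.mem_univ L),
      ← Finset.mul_prod_erase Finset.univ (fun j => (n j : ℝ) ^ k.get j) (Finset.mem_univ L),
      ← mul_assoc, ← sq]
    have h1 := pow_le_pow_right₀ (hpos L) hkL
    have h2 : ∏ j ∈ Finset.univ.erase L, (n j : ℝ) ≤
        ∏ j ∈ Finset.univ.erase L, (n j : ℝ) ^ k.get j :=
      Finset.prod_le_prod (fun j _ => (hpos' j).le) fun j _ =>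
        le_self_pow₀ (hpos j) (by have := hk j; omega)
    exact mul_le_mul h1 h2 (Finset.prod_nonneg fun j _ => (hpos' j).le) (by positivity)
  have hdist : ∏ j ∈ Finset.univ.erase i, (distances i n j : ℝ)⁻¹ ≤
      (n L : ℝ) ^ (ε * k.length) *
        ∏ j ∈ Finset.univ.erase i, (distances i n j : ℝ) ^ (-(1 + ε)) := by
    have h1 : ∀ j ∈ Finset.univ.erase i, (distances i n j : ℝ)⁻¹ ≤
        (n L : ℝ) ^ ε * (distances i n j : ℝ) ^ (-(1 + ε)) := by
      intro j _
      have : (distances i n j : ℝ)⁻¹ =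
          (distances i n j : ℝ) ^ ε * (distances i n j : ℝ) ^ (-(1 + ε)) := by
        rw [← Real.rpow_add (hdpos j), ← Real.rpow_neg_one]
        congr 1; ring
      rw [this]
      have := hdpos j
      have := Real.rpow_le_rpow (hdpos j).le (hdle j) hε
      gcongr
    refine (Finset.prod_le_prod (fun j _ => (inv_pos.2 (hdpos j)).le) h1).trans ?_
    rw [Finset.prod_mul_distrib, Finset.prod_const, ← Real.rpow_mul_natCast (hpos' L).le]
    refine mul_le_mul_of_nonneg_right ?_
      (Finset.prod_nonneg fun j _ => Real.rpow_nonneg (hdpos j).le _)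
    refine Real.rpow_le_rpow_of_exponent_le (hpos L) (mul_le_mul_of_nonneg_left ?_ hε)
    exact_mod_cast (Finset.card_le_univ _).trans_eq (Fintype.card_fin _)
  rw [norm_ohnoTerm s i hn]
  have hP : 0 < ∏ j ∈ Finset.univ.erase i, (n j : ℝ) := Finset.prod_pos fun j _ => hpos' j
  have hD : 0 ≤ ∏ j ∈ Finset.univ.erase i, (distances i n j : ℝ) ^ (-(1 + ε)) :=
    Finset.prod_nonneg fun j _ => Real.rpow_nonneg (hdpos j).le _
  have hL0 := hpos' L
  have hi0 := hpos' i
  have hiL : (n i : ℝ) ≤ n L := by exact_mod_cast hn.2.monotone (hL i)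
  have hLε : (n L : ℝ)⁻¹ * (n L : ℝ) ^ (ε * k.length) ≤ (n i : ℝ) ^ (-(1 - ε * k.length)) := by
    rw [← Real.rpow_neg_one, ← Real.rpow_add hL0, show -1 + ε * k.length = -(1 - ε * k.length) by
      ring]
    exact Real.rpow_le_rpow_of_nonpos hi0 hiL (by linarith)
  calc (∏ j, (n j : ℝ) ^ k.get j)⁻¹ * ((n i : ℝ) ^ s.re)⁻¹ *
      ((∏ j ∈ Finset.univ.erase i, (n j : ℝ)) *
        ∏ j ∈ Finset.univ.erase i, (distances i n j : ℝ)⁻¹)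
      ≤ ((n L : ℝ) * (n i * ∏ j ∈ Finset.univ.erase i, (n j : ℝ)))⁻¹ * ((n i : ℝ) ^ s.re)⁻¹ *
      ((∏ j ∈ Finset.univ.erase i, (n j : ℝ)) * ((n L : ℝ) ^ (ε * k.length) *
        ∏ j ∈ Finset.univ.erase i, (distances i n j : ℝ) ^ (-(1 + ε)))) := by
        gcongr
    _ = ((n L : ℝ)⁻¹ * (n L : ℝ) ^ (ε * k.length)) * ((n i : ℝ)⁻¹ * ((n i : ℝ) ^ s.re)⁻¹) *
        ∏ j ∈ Finset.univ.erase i, (distances i n j : ℝ) ^ (-(1 + ε)) := by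
        field_simp
    _ ≤ (n i : ℝ) ^ (-(1 - ε * k.length)) * ((n i : ℝ)⁻¹ * ((n i : ℝ) ^ s.re)⁻¹) *
        ∏ j ∈ Finset.univ.erase i, (distances i n j : ℝ) ^ (-(1 + ε)) := by
        gcongr
    _ = _ := by
        rw [← Real.rpow_neg_one, ← Real.rpow_neg hi0.le, ← Real.rpow_add hi0, ← Real.rpow_add hi0]
        congr 2
        ring

theorem summable_ohnoTerm {k : List ℕ} (hk : ∀ j, 1 ≤ k.get j) {L : Fin k.length}
    (hL : ∀ j, j ≤ L) (hkL : 2 ≤ k.get L) {s : ℂ} (hs : -1 < s.re) (i : Fin k.length) :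
    Summable fun n : summationTuples k.length => ohnoTerm k s i n := by
  have hr : (0 : ℝ) < k.length := by exact_mod_cast Fin.pos L
  -- With `r` the depth, `ε r ≤ 1` is needed for the termwise bound and `ε r < 1 + Re s` for the
  -- exponent of `n_i` to exceed `1`.
  set ε : ℝ := min 1 ((1 + s.re) / 2) / k.length with hεdef
  have hε : 0 < ε := div_pos (lt_min one_pos (by linarith)) hr
  have hεr : ε * k.length = min 1 ((1 + s.re) / 2) := div_mul_cancel₀ _ hr.ne'
  have hεs : ε * k.length < 1 + s.re := by
    rw [hεr]
    exact (min_le_right _ _).trans_lt (by linarith)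
  set h : Fin k.length → ℕ → ℝ := fun j x =>
    if j = i then (x : ℝ) ^ (-(2 + s.re - ε * k.length)) else (x : ℝ) ^ (-(1 + ε)) with hh
  have hsum : Summable fun x : Fin k.length → ℕ => ∏ j, h j (x j) := by
    refine summable_prod_pi (fun j n => ?_) fun j => ?_
    · simp only [hh]
      split_ifs <;> positivity
    · simp only [hh]
      split_ifs
      · exact Real.summable_nat_rpow.2 (by linarith)
      · exact Real.summable_nat_rpow.2 (by linarith)
  refine Summable.of_norm_bounded (hsum.comp_injective (distances_injective i)) fun n => ?_
  refine (norm_ohnoTerm_le hk hL hkL s hε.le (hεr.trans_le (min_le_left _ _)) i n.2).trans_eq ?_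
  simp only [Function.comp_apply]
  rw [← Finset.mul_prod_erase _ _ (Finset.mem_univ i)]
  congr 1
  · simp [hh, distances]
  · refine Finset.prod_congr rfl fun j hj => ?_
    simp [hh, Finset.ne_of_mem_erase hj]

lemma one_le_of_mem_blockIndex {d : ℕ} {a b : Fin d → ℕ} {x : ℕ} (hx : x ∈ blockIndex a b) :
    1 ≤ x := by
  simp only [blockIndex, List.mem_flatten, List.mem_ofFn] at hx
  obtain ⟨l, ⟨i, rfl⟩, hx⟩ := hx
  simp only [List.mem_append, List.mem_replicate, List.mem_singleton] at hx
  omega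

lemma blockIndex_concat {d : ℕ} (a b : Fin (d + 1) → ℕ) :
    ∃ l, blockIndex a b = l ++ [b (Fin.last d) + 1] := by
  refine ⟨(List.ofFn fun i : Fin d => List.replicate (a i.castSucc - 1) 1 ++
    [b i.castSucc + 1]).flatten ++ List.replicate (a (Fin.last d) - 1) 1, ?_⟩
  rw [blockIndex, List.ofFn_succ', List.concat_eq_append, List.flatten_append,
    List.flatten_singleton, List.append_assoc]

lemma exists_last_blockIndex {d : ℕ} (hd : 1 ≤ d) (a b : Fin d → ℕ) (hb : ∀ i, 1 ≤ b i) :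
    ∃ L : Fin (blockIndex a b).length, (∀ j, j ≤ L) ∧ 2 ≤ (blockIndex a b).get L := by
  obtain ⟨d, rfl⟩ := Nat.exists_eq_add_of_le' hd
  obtain ⟨l, hl⟩ := blockIndex_concat a b
  rw [hl]
  refine ⟨⟨l.length, by simp⟩, fun j => ?_, ?_⟩
  · have := j.2
    simp only [List.length_append, List.length_singleton] at this
    rw [Fin.le_def]
    simp only
    omega
  · have := hb (Fin.last d)
    simp
    omega

end Ohno

/-! ### Integrals of `x^s`, equality of the two measures, and the conclusion. -/

namespace Ohno

open MeasureTheory Set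
open scoped ENNReal Nat

lemma integrableOn_exp_mul_cpow {s : ℂ} (hs : -1 < s.re) {r : ℝ} (hr : 0 < r) :
    IntegrableOn (fun x : ℝ => ((Real.exp (-(r * x)) : ℝ) : ℂ) * (x : ℂ) ^ s) (Ioi 0) := by
  have h := integrableOn_rpow_mul_exp_neg_mul_rpow (p := 1) hs one_pos hr
  refine Integrable.mono' h ?_ ?_
  · refine Measurable.aestronglyMeasurable ?_
    fun_prop
  · filter_upwards [self_mem_ae_restrict measurableSet_Ioi] with x hx
    rw [norm_mul, Complex.norm_cpow_eq_rpow_re_of_pos hx, Complex.norm_real, Real.norm_eq_abs,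
      Real.abs_exp, mul_comm, Real.rpow_one, neg_mul]

lemma integral_exp_mul_cpow {s : ℂ} (hs : -1 < s.re) {r : ℝ} (hr : 0 < r) :
    ∫ x in Ioi (0 : ℝ), ((Real.exp (-(r * x)) : ℝ) : ℂ) * (x : ℂ) ^ s =
      (1 / (r : ℂ)) ^ (s + 1) * Complex.Gamma (s + 1) := by
  rw [← Complex.integral_cpow_mul_exp_neg_mul_Ioi (by simp; linarith) hr]
  refine setIntegral_congr_fun measurableSet_Ioi fun x _ => ?_
  push_cast
  rw [add_sub_cancel_right, mul_comm]

lemma expDensity_mul_cpow {r : ℕ} (n : Fin r → ℕ) (s : ℂ) (x : ℝ) :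
    ((expDensity n x : ℝ) : ℂ) * (x : ℂ) ^ s =
      ∑ i, (∏ j ∈ Finset.univ.erase i, ((n j : ℂ) - n i)⁻¹) *
        (((Real.exp (-(n i * x)) : ℝ) : ℂ) * (x : ℂ) ^ s) := by
  rw [expDensity, Complex.ofReal_sum, Finset.sum_mul]
  refine Finset.sum_congr rfl fun i _ => ?_
  push_cast
  ring

lemma integral_expDensity_mul_cpow {r : ℕ} {n : Fin r → ℕ} (hn : ∀ j, 0 < n j) {s : ℂ}
    (hs : -1 < s.re) :
    ∫ x in Ioi (0 : ℝ), ((expDensity n x : ℝ) : ℂ) * (x : ℂ) ^ s =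
      ∑ i, (∏ j ∈ Finset.univ.erase i, ((n j : ℂ) - n i)⁻¹) *
        ((1 / (n i : ℂ)) ^ (s + 1) * Complex.Gamma (s + 1)) := by
  have hn' : ∀ j, (0 : ℝ) < n j := fun j => by exact_mod_cast hn j
  simp only [expDensity_mul_cpow]
  rw [integral_finsetSum _ fun i _ => (integrableOn_exp_mul_cpow hs (hn' i)).const_mul _]
  refine Finset.sum_congr rfl fun i _ => ?_
  rw [integral_const_mul, integral_exp_mul_cpow hs (hn' i), Complex.ofReal_natCast]

lemma integrableOn_expDensity_mul_cpow {r : ℕ} {n : Fin r → ℕ} (hn : ∀ j, 0 < n j) {s : ℂ}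
    (hs : -1 < s.re) :
    IntegrableOn (fun x : ℝ => ((expDensity n x : ℝ) : ℂ) * (x : ℂ) ^ s) (Ioi 0) := by
  have hn' : ∀ j, (0 : ℝ) < n j := fun j => by exact_mod_cast hn j
  simp only [expDensity_mul_cpow]
  exact integrable_finsetSum _ fun i _ => (integrableOn_exp_mul_cpow hs (hn' i)).const_mul _

/-- `∏_j n_j^{-(k_j - 1)}`. -/
noncomputable def tupleCoeff (k : List ℕ) (n : Fin k.length → ℕ) : ℝ :=
  ∏ j, ((n j : ℝ) ^ (k.get j - 1))⁻¹

lemma tupleCoeff_nonneg (k : List ℕ) (n : Fin k.length → ℕ) : 0 ≤ tupleCoeff k n :=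
  Finset.prod_nonneg fun j _ => by positivity

/-- The factor `1/n_i` from `n_i^{-s-1}` and the numerators `n_j`, `j ≠ i`, of `ohnoTerm` together
account for lowering every exponent from `k_j` to `k_j - 1`. -/
lemma tupleCoeff_mul_integral {k : List ℕ} (hk : ∀ j, 1 ≤ k.get j) {n : Fin k.length → ℕ}
    (hn : n ∈ summationTuples k.length) {s : ℂ} (hs : -1 < s.re) :
    ∫ x in Ioi (0 : ℝ), ((tupleCoeff k n * expDensity n x : ℝ) : ℂ) * (x : ℂ) ^ s =
      Complex.Gamma (s + 1) * ∑ i, ohnoTerm k s i n := by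
  have hn0 : ∀ j, (n j : ℂ) ≠ 0 := fun j => by exact_mod_cast (hn.1 j).ne'
  simp only [Complex.ofReal_mul, mul_assoc]
  rw [integral_const_mul, integral_expDensity_mul_cpow hn.1 hs, Finset.mul_sum, Finset.mul_sum]
  refine Finset.sum_congr rfl fun i _ => ?_
  have h1 : ∏ j, (n j : ℂ) ^ k.get j =
      (∏ j, (n j : ℂ) ^ (k.get j - 1)) * ((n i : ℂ) * ∏ j ∈ Finset.univ.erase i, (n j : ℂ)) := by
    rw [Finset.mul_prod_erase Finset.univ (fun j => (n j : ℂ)) (Finset.mem_univ i),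
      ← Finset.prod_mul_distrib]
    exact Finset.prod_congr rfl fun j _ => by rw [pow_sub_one_mul (by have := hk j; omega)]
  have h2 : (1 / (n i : ℂ)) ^ (s + 1) = ((n i : ℂ) ^ s)⁻¹ * (n i : ℂ)⁻¹ := by
    rw [one_div, Complex.inv_cpow _ _ (by rw [Complex.natCast_arg]; exact Real.pi_ne_zero.symm),
      Complex.cpow_add _ _ (hn0 i), Complex.cpow_one, mul_inv]
  have h3 : ∏ j ∈ Finset.univ.erase i, (n j : ℂ) ≠ 0 := Finset.prod_ne_zero_iff.2 fun j _ => hn0 j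
  have h4 : ((tupleCoeff k n : ℝ) : ℂ) = (∏ j, (n j : ℂ) ^ (k.get j - 1))⁻¹ := by
    rw [tupleCoeff, ← Finset.prod_inv_distrib]
    push_cast
    rfl
  have h5 : (∏ j, (n j : ℂ) ^ (k.get j - 1)) ≠ 0 :=
    Finset.prod_ne_zero_iff.2 fun j _ => pow_ne_zero _ (hn0 j)
  have h6 := hn0 i
  have h7 : (n i : ℂ) ^ s ≠ 0 := by
    rw [Complex.cpow_def_of_ne_zero h6]
    exact Complex.exp_ne_zero _
  rw [ohnoTerm, h1, h2, h4]
  simp only [div_eq_mul_inv, Finset.prod_mul_distrib, mul_inv, one_mul]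
  field_simp

/-- The measure on `(0, ∞)` with density `∏ n_j^{-(k_j-1)}` times `expDensity n`. -/
noncomputable def tupleMeasure (k : List ℕ) (n : Fin k.length → ℕ) : Measure ℝ :=
  (volume.restrict (Ioi 0)).withDensity fun x => ENNReal.ofReal (tupleCoeff k n * expDensity n x)

lemma expDensity_nonneg {r : ℕ} {n : Fin r → ℕ} (hn : Function.Injective n) {x : ℝ} (hx : 0 < x) :
    0 ≤ expDensity n x := by
  cases r with
  | zero => simp [expDensity]
  | succ r => exact (expIter_eq_lintegral_expDensity n hn).1 x hx

lemma ae_toReal_ofReal_smul (k : List ℕ) {n : Fin k.length → ℕ}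
    (hn : n ∈ summationTuples k.length) (s : ℂ) :
    (fun x : ℝ => (ENNReal.ofReal (tupleCoeff k n * expDensity n x)).toReal • (x : ℂ) ^ s)
      =ᵐ[volume.restrict (Ioi 0)]
        fun x => ((tupleCoeff k n * expDensity n x : ℝ) : ℂ) * (x : ℂ) ^ s := by
  filter_upwards [self_mem_ae_restrict measurableSet_Ioi] with x hx
  rw [ENNReal.toReal_ofReal
    (mul_nonneg (tupleCoeff_nonneg k n) (expDensity_nonneg hn.2.injective hx)), Complex.real_smul]

lemma integral_tupleMeasure {k : List ℕ} (hk : ∀ j, 1 ≤ k.get j) {n : Fin k.length → ℕ}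
    (hn : n ∈ summationTuples k.length) {s : ℂ} (hs : -1 < s.re) :
    ∫ x, (x : ℂ) ^ s ∂tupleMeasure k n = Complex.Gamma (s + 1) * ∑ i, ohnoTerm k s i n := by
  rw [tupleMeasure, integral_withDensity_eq_integral_toReal_smul (by fun_prop) (by simp),
    integral_congr_ae (ae_toReal_ofReal_smul k hn s), tupleCoeff_mul_integral hk hn hs]

lemma integrable_tupleMeasure {k : List ℕ} {n : Fin k.length → ℕ}
    (hn : n ∈ summationTuples k.length) {s : ℂ} (hs : -1 < s.re) :
    Integrable (fun x : ℝ => (x : ℂ) ^ s) (tupleMeasure k n) := by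
  rw [tupleMeasure, integrable_withDensity_iff_integrable_smul' (by fun_prop) (by simp),
    integrable_congr (ae_toReal_ofReal_smul k hn s)]
  simp only [Complex.ofReal_mul, mul_assoc]
  exact (integrableOn_expDensity_mul_cpow hn.1 hs).const_mul _

lemma ae_pos_tupleMeasure (k : List ℕ) (n : Fin k.length → ℕ) : ∀ᵐ x ∂tupleMeasure k n, 0 < x :=
  (withDensity_absolutelyContinuous _ _).ae_le (self_mem_ae_restrict measurableSet_Ioi)

/-- On `(0,∞)` one has `|x^s| = x^{Re s}`, so the absolute integral is again a sum of Ohno terms,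
now at the real point `Re s`. -/
lemma integral_norm_tupleMeasure {k : List ℕ} (hk : ∀ j, 1 ≤ k.get j) {n : Fin k.length → ℕ}
    (hn : n ∈ summationTuples k.length) {s : ℂ} (hs : -1 < s.re) :
    ∫ x, ‖((x : ℝ) : ℂ) ^ s‖ ∂tupleMeasure k n =
      ‖Complex.Gamma (s.re + 1) * ∑ i, ohnoTerm k s.re i n‖ := by
  rw [← integral_tupleMeasure hk hn (by simpa using hs)]
  have h : (fun x : ℝ => (x : ℂ) ^ (s.re : ℂ)) =ᵐ[tupleMeasure k n]
      fun x : ℝ => ((‖(x : ℂ) ^ s‖ : ℝ) : ℂ) := by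
    filter_upwards [ae_pos_tupleMeasure k n] with x hx
    rw [Complex.norm_cpow_eq_rpow_re_of_pos hx, Complex.ofReal_cpow hx.le]
  rw [integral_congr_ae h, integral_complex_ofReal, Complex.norm_real, Real.norm_of_nonneg]
  exact integral_nonneg fun x => norm_nonneg _

theorem integrable_sum_tupleMeasure {k : List ℕ} (hk : ∀ j, 1 ≤ k.get j) {L : Fin k.length}
    (hL : ∀ j, j ≤ L) (hkL : 2 ≤ k.get L) {s : ℂ} (hs : -1 < s.re) :
    Integrable (fun x : ℝ => (x : ℂ) ^ s)
      (Measure.sum fun n : summationTuples k.length => tupleMeasure k n) := by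
  rw [integrable_sum_measure_iff]
  refine ⟨fun n => integrable_tupleMeasure n.2 hs, ?_⟩
  simp only [fun n : summationTuples k.length => integral_norm_tupleMeasure hk n.2 hs]
  refine Summable.norm (Summable.mul_left _ ?_)
  exact summable_sum fun i _ => summable_ohnoTerm hk hL hkL (by simpa using hs) i

theorem integral_sum_tupleMeasure {k : List ℕ} (hk : ∀ j, 1 ≤ k.get j) {L : Fin k.length}
    (hL : ∀ j, j ≤ L) (hkL : 2 ≤ k.get L) {s : ℂ} (hs : -1 < s.re) :
    ∫ x, (x : ℂ) ^ s ∂(Measure.sum fun n : summationTuples k.length => tupleMeasure k n) =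
      Complex.Gamma (s + 1) * ohnoFunction k s := by
  rw [integral_sum_measure (integrable_sum_tupleMeasure hk hL hkL hs),
    tsum_congr fun n : summationTuples k.length => integral_tupleMeasure hk n.2 hs, tsum_mul_left,
    ohnoFunction, Summable.tsum_finsetSum fun i _ => summable_ohnoTerm hk hL hkL hs i]

lemma lintegral_tupleMeasure {k : List ℕ} (hk : k ≠ []) {n : Fin k.length → ℕ}
    (hn : n ∈ summationTuples k.length) {f : ℝ → ℝ≥0∞} (hf : Measurable f) :
    ∫⁻ x, f x ∂tupleMeasure k n =
      ENNReal.ofReal (∏ j, ((n j : ℝ) ^ (k.get j - 1))⁻¹) * expIter k.length n f := by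
  obtain ⟨a, l, rfl⟩ := List.exists_cons_of_ne_nil hk
  have h := (expIter_eq_lintegral_expDensity (r := l.length) n hn.2.injective).2 f hf
  rw [tupleMeasure, lintegral_withDensity_eq_lintegral_mul _ (by fun_prop) hf]
  change _ = _ * expIter (l.length + 1) n f
  rw [h, ← lintegral_const_mul _ (by
    have := measurable_expDensity (r := l.length + 1) n
    fun_prop)]
  refine lintegral_congr fun x => ?_
  rw [Pi.mul_apply, ENNReal.ofReal_mul (tupleCoeff_nonneg _ n), mul_assoc]
  rfl

/-- The law of `logRatio` under the block density is the sum of the tuple measures. -/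
theorem sum_tupleMeasure_blockIndex {d : ℕ} (hd : 1 ≤ d) (a b : Fin d → ℕ)
    (hb : ∀ i, 1 ≤ b i) :
    (Measure.sum fun n : summationTuples (blockIndex a b).length =>
      tupleMeasure (blockIndex a b) n) =
      (volume.withDensity (blockWeight a b)).map logRatio := by
  refine Measure.ext_of_lintegral _ fun f hf => ?_
  have hne : blockIndex a b ≠ [] := by
    obtain ⟨L, -⟩ := exists_last_blockIndex hd a b hb
    exact List.ne_nil_of_length_pos L.pos
  have h1 := represents_tailSum_blockIndex d a b hb 0 le_rfl f hf
  rw [tailSum_eq_tsum _ _ hf] at h1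
  rw [lintegral_sum_measure, lintegral_map hf (by fun_prop),
    lintegral_withDensity_eq_lintegral_mul _ (by fun_prop) (by fun_prop)]
  simp only [pow_zero, ENNReal.ofReal_one, one_mul] at h1
  refine Eq.trans ?_ h1
  -- Tuples above `m = 0` are by definition the summation tuples.
  exact tsum_congr fun n : summationTuples (blockIndex a b).length =>
    lintegral_tupleMeasure hne n.2 hf

lemma toReal_blockWeight_smul {d : ℕ} (a b : Fin d → ℕ) (s : ℂ) :
    (fun t => (blockWeight a b t).toReal • ((logRatio t : ℝ) : ℂ) ^ s) =
      (orderedSimplex (2 * d)).indicator fun t =>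
        (blockFactorial a b : ℂ)⁻¹ * ohnoIntegrand a b s t := by
  ext t
  by_cases ht : t ∈ orderedSimplex (2 * d)
  · rw [blockWeight, indicator_of_mem ht, indicator_of_mem ht, ENNReal.toReal_ofReal
      (div_nonneg (blockDensity_nonneg a b ht) (Nat.cast_nonneg _)), Complex.real_smul,
      Complex.ofReal_div, Complex.ofReal_natCast, div_eq_inv_mul, mul_assoc]
    rfl
  · simp [blockWeight, ht]

end Ohno

theorem mainTheorem2 (d : ℕ) (hd : 1 ≤ d) (a b : Fin d → ℕ)
    (ha : ∀ i, 1 ≤ a i) (hb : ∀ i, 1 ≤ b i) (s : ℂ) (hs : -1 < s.re) :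
    (∀ i, Summable fun n : Ohno.summationTuples (Ohno.blockIndex a b).length =>
      Ohno.ohnoTerm (Ohno.blockIndex a b) s i n) ∧
    MeasureTheory.IntegrableOn (Ohno.ohnoIntegrand a b s) (Ohno.orderedSimplex (2 * d))
      MeasureTheory.volume ∧
    Ohno.ohnoFunction (Ohno.blockIndex a b) s =
      1 / ((∏ i, ((Nat.factorial (a i - 1) : ℂ) * (Nat.factorial (b i - 1) : ℂ))) *
          Complex.Gamma (s + 1)) *
        ∫ t in Ohno.orderedSimplex (2 * d), Ohno.ohnoIntegrand a b s t := by
  have hk : ∀ j, 1 ≤ (Ohno.blockIndex a b).get j := fun j =>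
    Ohno.one_le_of_mem_blockIndex (List.get_mem _ _)
  obtain ⟨L, hL, hkL⟩ := Ohno.exists_last_blockIndex hd a b hb
  have hfac : (Ohno.blockFactorial a b : ℂ) ≠ 0 := by
    exact_mod_cast (Ohno.blockFactorial_pos a b).ne'
  have hlt : ∀ᵐ t, Ohno.blockWeight a b t < ⊤ := by
    refine Filter.Eventually.of_forall fun t => ?_
    unfold Ohno.blockWeight Set.indicator
    split_ifs <;> simp
  have hmeas : Measurable fun x : ℝ => (x : ℂ) ^ s := by fun_prop
  have hint := Ohno.integrable_sum_tupleMeasure hk hL hkL hs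
  have heq := Ohno.integral_sum_tupleMeasure hk hL hkL hs
  -- Integrability and the value of the integral are both known on the series side; the equality of
  -- measures carries them to the simplex.
  rw [Ohno.sum_tupleMeasure_blockIndex hd a b hb] at hint heq
  rw [MeasureTheory.integrable_map_measure hmeas.aestronglyMeasurable (by fun_prop),
    MeasureTheory.integrable_withDensity_iff_integrable_smul' (by fun_prop) hlt] at hint
  rw [MeasureTheory.integral_map (by fun_prop) hmeas.aestronglyMeasurable,
    integral_withDensity_eq_integral_toReal_smul (by fun_prop) hlt] at heq
  simp only [Function.comp_def] at hint
  rw [Ohno.toReal_blockWeight_smul] at hint heq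
  rw [MeasureTheory.integrable_indicator_iff (Ohno.measurableSet_orderedSimplex _)] at hint
  rw [MeasureTheory.integral_indicator (Ohno.measurableSet_orderedSimplex _),
    MeasureTheory.integral_const_mul] at heq
  refine ⟨fun i => Ohno.summable_ohnoTerm hk hL hkL hs i, ?_, ?_⟩
  · refine (hint.const_mul (Ohno.blockFactorial a b : ℂ)).congr ?_
    filter_upwards with t
    rw [mul_inv_cancel_left₀ hfac]
  · have hG : Complex.Gamma (s + 1) ≠ 0 :=
      Complex.Gamma_ne_zero_of_re_pos (by simp; linarith)
    have hprod : (∏ i, ((Nat.factorial (a i - 1) : ℂ) * (Nat.factorial (b i - 1) : ℂ))) =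
        (Ohno.blockFactorial a b : ℂ) := by
      simp [Ohno.blockFactorial]
    rw [hprod, ← mul_right_inj' hG, ← heq]
    field_simp
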